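/- Let $I$ and $O$ be finite sets, $h:I\to O$ a surjective function, and $\Lambda=(\lambda_{ij})_{i,j\in I}$ a rate transition matrix ($\lambda_{ij}\ge 0$ for $i\ne j$, $\sum_j\lambda_{ij}=0$ for all $i$). On a probability space $(\Omega,\mathcal F,\mathbb P)$ let $(X_t)_{t\ge0}$ be an $I$-valued process with cadlag (hence piecewise constant) paths which is Markov with generator $\Lambda$, i.e. $\mathbb E[f(X_{t+s})\mid\sigma(X_r:r\le t)]=(e^{s\Lambda}f)(X_t)$ $\mathbb P$-a.s. for all $s,t\ge0$ and $f:I\to\mathbb R$, and let $\mu(i)=\mathbb P(X_0=i)$, $i\in I$. Let $Y_t=h(X_t)$ and $\mathcal Y^0_t=\sigma(Y_s:s\in[0,t])$. Let $T_0=0$ and let $T_1<T_2<\cdots$ be the successive jump times of $Y$, with $T_j=T_{j+1}=\dots=\infty$ if there are fewer than $j$ jumps. Vectors in $\mathbb R^I$ are row vectors when multiplied by $\Lambda$ on the right; $1_{h^{-1}(a)}$ is the indicator (column) vector of $h^{-1}(a)$, $*$ is the componentwise product, and $\nu f=\sum_{i}\nu(i)f(i)$. For each $a\in O$ fix an arbitrary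 probability $\nu_a$ on $I$ supported in $h^{-1}(a)$, and for $x\in\mathbb R^I$ put $$H_a[x]=\frac{1_{h^{-1}(a)}*x}{x1_{h^{-1}(a)}}\ \text{ if } x1_{h^{-1}(a)}\ne0,\qquad H_a[x]=\nu_a\ \text{ if } x1_{h^{-1}(a)}=0 .$$ Then for every $\omega\in\Omega$ the filtering equation $$\Pi_t=H_{Y_0}[\mu]+\int_0^t\Big\{1_{h^{-1}(Y_s)}*(\Pi_s\Lambda)-(\Pi_s\Lambda 1_{h^{-1}(Y_s)})\,\Pi_s\Big\}\,ds+\sum_{j\ge1,\;T_j\le t}\Big\{H_{Y_{T_j}}[\Pi_{T_j-}\Lambda]-\Pi_{T_j-}\Big\},\qquad t\ge0,$$ has a unique cadlag solution $t\mapsto\Pi_t(\omega)\in\mathbb R^I$. Equivalently described, $\Pi_0=H_{Y_0}[\mu]$; for each $j\ge 0$ with $T_j<\infty$, $\Pi_t=y(t-T_j)$ for $T_j\le t<T_{j+1}$, where $y$ is a global solution on $[0,\infty)$ of $y'=1_{h^{-1}(a)}*(y\Lambda)-(y\Lambda 1_{h^{-1}(a)})\,y$, $y(0)=\Pi_{T_j}$,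 with $a=Y_{T_j}$; and if $T_{j+1}<\infty$, then $\Pi_{T_{j+1}-}=y(T_{j+1}-T_j)$ and $\Pi_{T_{j+1}}=H_{Y_{T_{j+1}}}[\Pi_{T_{j+1}-}\Lambda]$. The process $\Pi$ so defined is a modification of the filtering process: for every $t\ge0$ and $i\in I$, $$\Pi_t(i)=\mathbb P(X_t=i\mid\mathcal Y^0_t)\qquad \mathbb P\text{-a.s.}$$ -/

import Mathlib

open MeasureTheory ProbabilityTheory Filter Topology
open scoped NNReal ENNReal Matrix

namespace NoiseFreeFilter

noncomputable section

/-- A rate transition matrix (Q-matrix): nonnegative off-diagonal entries, zero row sums. -/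
def IsRateMatrix {I : Type*} [Fintype I] (Λ : Matrix I I ℝ) : Prop :=
  (∀ i j, i ≠ j → 0 ≤ Λ i j) ∧ ∀ i, ∑ j, Λ i j = 0

/-- A function on `[0, ∞)` that is right-continuous and has left limits
(at `0` the left-limit condition is void). -/
def IsCadlag {E : Type*} [TopologicalSpace E] (f : ℝ≥0 → E) : Prop :=
  ∀ t, ContinuousWithinAt f (Set.Ici t) t ∧ ∃ l, Tendsto f (𝓝[<] t) (𝓝 l)

/-- The σ-algebra `σ(Z_s : s ∈ [0, t])` generated by a process with values in a finite (discrete)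
space. -/
@[reducible] def pastSigma {Ω S : Type*} (Z : ℝ≥0 → Ω → S) (t : ℝ≥0) : MeasurableSpace Ω :=
  ⨆ s : ℝ≥0, ⨆ _ : s ≤ t, MeasurableSpace.comap (Z s) ⊤

/-- `X` is a Markov process with generator `Λ` with respect to its natural filtration:
each `X_t` is a random variable and `E[f(X_{t+s}) | σ(X_r : r ≤ t)] = (e^{sΛ} f)(X_t)` a.s. -/
def IsMarkovWithGenerator {I Ω : Type*} [Fintype I] [DecidableEq I] [MeasurableSpace Ω]
    (P : Measure Ω) (Λ : Matrix I I ℝ) (X : ℝ≥0 → Ω → I) : Prop :=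
  (∀ t i, MeasurableSet (X t ⁻¹' {i})) ∧
  ∀ (t s : ℝ≥0) (f : I → ℝ),
    P[fun ω => f (X (t + s) ω) | pastSigma X t]
      =ᵐ[P] fun ω => (NormedSpace.exp ((s : ℝ) • Λ) *ᵥ f) (X t ω)

/-- The indicator vector `1_{h⁻¹(a)}`. -/
def levelInd {I O : Type*} (h : I → O) (a : O) : I → ℝ :=
  (h ⁻¹' {a}).indicator 1

/-- `Δ_a`: probability vectors on `I` supported in the level set `h⁻¹(a)`. -/
def levelSimplex {I O : Type*} [Fintype I] (h : I → O) (a : O) : Set (I → ℝ) :=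
  {x | x ∈ stdSimplex ℝ I ∧ ∀ i, h i ≠ a → x i = 0}

/-- The vector field `F_a(y) = 1_{h⁻¹(a)} * (yΛ) - (yΛ 1_{h⁻¹(a)}) y`. -/
def field {I O : Type*} [Fintype I] (Λ : Matrix I I ℝ) (h : I → O) (a : O) (y : I → ℝ) :
    I → ℝ :=
  levelInd h a * (y ᵥ* Λ) - ((y ᵥ* Λ) ⬝ᵥ levelInd h a) • y

/-- `y` is a global solution on `[0, ∞)` of `y' = F_a(y)`, `y(0) = x`, i.e. `y(t) = φ_a(t, x)`.
(Values of `y` at negative times play no role.) -/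
def IsFlowCurve {I O : Type*} [Fintype I] (Λ : Matrix I I ℝ) (h : I → O) (a : O) (x : I → ℝ)
    (y : ℝ → I → ℝ) : Prop :=
  y 0 = x ∧ ∀ t, 0 ≤ t → HasDerivWithinAt y (field Λ h a (y t)) (Set.Ici 0) t

/-- The operator `H_a`: normalized restriction to `h⁻¹(a)`, with the default value `ν a` when the
normalizing sum vanishes. -/
def opH {I O : Type*} [Fintype I] (h : I → O) (ν : O → I → ℝ) (a : O) (x : I → ℝ) : I → ℝ :=
  if x ⬝ᵥ levelInd h a ≠ 0 then (x ⬝ᵥ levelInd h a)⁻¹ • (levelInd h a * x) else ν a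

/-- The jump times `T_0 = 0 < T_1 < T_2 < ⋯` of a piecewise constant right-continuous path `y`:
`T_{j+1}` is the first time after `T_j` at which `y` takes a value different from `y(T_j)`,
and `T_{j+1} = ∞` if there is no such time. -/
def jumpTime {O : Type*} (y : ℝ≥0 → O) : ℕ → ℝ≥0∞
  | 0 => 0
  | j + 1 => sInf {s : ℝ≥0∞ | ∃ t : ℝ≥0, s = (t : ℝ≥0∞) ∧ jumpTime y j < (t : ℝ≥0∞) ∧
      y t ≠ y (jumpTime y j).toNNReal}

/-- The cadlag path `p` solves the filtering equation driven by the observed path `y`: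
`p_t = H_{y_0}[μ] + ∫_0^t F_{y_s}(p_s) ds + ∑_{0 < T_j ≤ t} (H_{y_{T_j}}[p_{T_j-} Λ] - p_{T_j-})`
for all `t ≥ 0`, with `T_j` the jump times of `y`. -/
def SolvesFilteringEq {I O : Type*} [Fintype I] (Λ : Matrix I I ℝ) (h : I → O) (ν : O → I → ℝ)
    (μ : I → ℝ) (y : ℝ≥0 → O) (p : ℝ≥0 → I → ℝ) : Prop :=
  IsCadlag p ∧ ∀ t : ℝ≥0,
    p t = opH h ν (y 0) μ
      + (∫ s in (0 : ℝ)..t, field Λ h (y s.toNNReal) (p s.toNNReal))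
      + ∑ᶠ (j : ℕ) (_ : 1 ≤ j ∧ jumpTime y j ≤ t),
          (opH h ν (y (jumpTime y j).toNNReal)
              (Function.leftLim p (jumpTime y j).toNNReal ᵥ* Λ)
            - Function.leftLim p (jumpTime y j).toNNReal)

/-- The piecewise description of the path `p`: it starts at `H_{y_0}[μ]`, it follows the flow
`p_t = φ(t - T_j, p_{T_j})` on each `[T_j, T_{j+1})`, and at each finite jump time
`p_{T_{j+1}} = H_{y_{T_{j+1}}}[p_{T_{j+1}-} Λ]` with `p_{T_{j+1}-} = φ(T_{j+1} - T_j, p_{T_j})`. -/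
def FollowsFlowWithJumps {I O : Type*} [Fintype I] (Λ : Matrix I I ℝ) (h : I → O)
    (ν : O → I → ℝ) (μ : I → ℝ) (y : ℝ≥0 → O) (p : ℝ≥0 → I → ℝ) : Prop :=
  p 0 = opH h ν (y 0) μ ∧
  ∀ j : ℕ, jumpTime y j ≠ ∞ →
    ∃ φ : ℝ → I → ℝ,
      IsFlowCurve Λ h (y (jumpTime y j).toNNReal) (p (jumpTime y j).toNNReal) φ ∧
      (∀ t : ℝ≥0, jumpTime y j ≤ t → t < jumpTime y (j + 1) →
        p t = φ ((t : ℝ) - (jumpTime y j).toReal)) ∧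
      (jumpTime y (j + 1) ≠ ∞ →
        Function.leftLim p (jumpTime y (j + 1)).toNNReal
            = φ ((jumpTime y (j + 1)).toReal - (jumpTime y j).toReal) ∧
        p (jumpTime y (j + 1)).toNNReal
            = opH h ν (y (jumpTime y (j + 1)).toNNReal)
                (Function.leftLim p (jumpTime y (j + 1)).toNNReal ᵥ* Λ))

end

end NoiseFreeFilter

/-!
Between two jumps of the observation `Y`, the quadratic equation `y' = F_a(y)` is the projection of
a linear one: with `D` the projection to the level set `h⁻¹(a)`, its solution started at a
probability vector `x` is `x e^{tDΛD}` divided by its total mass, and the mass stays positive because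
`DΛD` has nonnegative off-diagonal entries (`isFlowCurve_flow`). Since the jump times of a step path
do not accumulate, gluing these curves gives a cadlag path `filterPath` with the required flow
description; integrating over the intervals between jumps turns this description into the filtering
equation (`solvesFilteringEq_of_followsFlowWithJumps`). Uniqueness holds because the vector field is
locally Lipschitz between jumps and the right-hand side of the equation at a jump time depends only
on the path before that time (`SolvesFilteringEq.unique`).

For the probabilistic statement, observe `Y` only on the grid `0, δ, …, Nδ = t`. By the Markov
property the conditional law of `X_t` is then the normalization of `μ D₀ Q D₁ Q ⋯ Q D_N`, where
`Q = e^{δΛ}` and `D_k` projects to the level set of `Y_{kδ}` (`condExp_gridValues`). As the dyadic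
grids are refined, Lévy's upward theorem gives almost sure convergence of these conditional laws to
the conditional law given the whole past of `Y`, because right-continuity makes the grid observations
generate that past (`iSup_comap_gridValues`). On the other hand, along a fixed path, `(D Q D)^m`
tends to `e^{τDΛD}` on the range of `D` when `mδ → τ`, and `δ⁻¹ D Q D'` tends to `D Λ D'` for distinct
levels. So after division by one factor `δ` for each jump, the product converges to the unnormalized
filter `unnormPath` (`tendsto_gridWeight_gridIndex`), whose normalization is `filterPath`, provided
that it does not vanish.

That it does not vanish almost surely is where the default values `ν` become irrelevant. Almost
surely `X` starts in the support of `μ` and makes no jump of rate zero, since the probability of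
seeing such a jump on a grid of mesh `δ` is `(t / δ) o(δ)` (`measure_jump_eq_zero`); and along a path
with these two properties the unnormalized filter charges the current state of `X` at every time
(`unnormPath_apply_pos`).
-/

namespace NoiseFreeFilter

noncomputable section

/-! ### Exponentials of matrices with nonnegative off-diagonal entries -/

section MatrixExp

variable {I : Type*} [Fintype I] [DecidableEq I]

attribute [local instance] Matrix.linftyOpNormedRing Matrix.linftyOpNormedAlgebra

theorem hasDerivAt_exp_smul (M : Matrix I I ℝ) (t : ℝ) :
    HasDerivAt (fun s : ℝ => NormedSpace.exp (s • M)) (NormedSpace.exp (t • M) * M) t :=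
  hasDerivAt_exp_smul_const (𝕂 := ℝ) M t

theorem hasDerivAt_vecMul_exp_smul (M : Matrix I I ℝ) (x : I → ℝ) (t : ℝ) :
    HasDerivAt (fun s : ℝ => x ᵥ* NormedSpace.exp (s • M))
      ((x ᵥ* NormedSpace.exp (t • M)) ᵥ* M) t := by
  have h1 := hasDerivAt_exp_smul M t
  have h2 : Continuous (Matrix.vecMulBilin ℝ ℝ (m := I) (n := I) x) := by
    change Continuous fun N : Matrix I I ℝ => x ᵥ* N
    fun_prop
  have h3 := (ContinuousLinearMap.mk _ h2).hasFDerivAt.comp_hasDerivAt t h1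
  rw [Matrix.vecMul_vecMul]
  exact h3

theorem exp_add_smul (M : Matrix I I ℝ) (s t : ℝ) :
    NormedSpace.exp ((s + t) • M) = NormedSpace.exp (s • M) * NormedSpace.exp (t • M) := by
  rw [add_smul]
  exact Matrix.exp_add_of_commute _ _ (((Commute.refl M).smul_left s).smul_right t)

/-- For an entrywise nonnegative matrix the exponential dominates its first two Taylor terms. -/
theorem one_add_le_exp_apply {N : Matrix I I ℝ} (hN : ∀ i j, 0 ≤ N i j) (i j : I) :
    (1 : Matrix I I ℝ) i j + N i j ≤ NormedSpace.exp N i j := by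
  have h1 : HasSum (fun n : ℕ => ((n.factorial : ℝ)⁻¹) • N ^ n) (NormedSpace.exp N) :=
    NormedSpace.exp_series_hasSum_exp' (𝕂 := ℝ) N
  have h2 : HasSum (fun n : ℕ => ((n.factorial : ℝ)⁻¹) * (N ^ n) i j)
      (NormedSpace.exp N i j) := by
    have := Pi.hasSum.1 (Pi.hasSum.1 h1 i) j
    simpa using this
  have hpow : ∀ (n : ℕ) i j, 0 ≤ (N ^ n) i j := by
    intro n
    induction n with
    | zero => intro i j; by_cases hij : i = j <;> simp [hij]
    | succ n ih =>
      intro i j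
      rw [pow_succ, Matrix.mul_apply]
      exact Finset.sum_nonneg fun k _ => mul_nonneg (ih _ _) (hN _ _)
  have h3 := sum_le_hasSum (Finset.range 2)
    (fun n _ => mul_nonneg (by positivity) (hpow n i j)) h2
  simpa [Finset.sum_range_succ] using h3

/-- Shifting by a multiple of the identity makes the matrix nonnegative, and multiplies the
exponential by a positive scalar. -/
theorem exists_le_exp_smul_apply {M : Matrix I I ℝ} (hM : ∀ i j, i ≠ j → 0 ≤ M i j) {s : ℝ}
    (hs : 0 ≤ s) : ∃ c > 0, ∀ i j,
      (i ≠ j → c * (s * M i j) ≤ NormedSpace.exp (s • M) i j) ∧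
      (i = j → c ≤ NormedSpace.exp (s • M) i j) := by
  set b : ℝ := ∑ i, |M i i| with hb
  have hbi : ∀ i, |M i i| ≤ b := fun i =>
    Finset.single_le_sum (f := fun i => |M i i|) (fun _ _ => abs_nonneg _) (Finset.mem_univ i)
  set N : Matrix I I ℝ := s • (M + b • 1) with hNdef
  have hNd : ∀ i, N i i = s * (M i i + b) := fun i => by simp [hNdef, mul_add]
  have hNo : ∀ i j, i ≠ j → N i j = s * M i j := fun i j hij => by simp [hNdef, hij]
  have hN : ∀ i j, 0 ≤ N i j := by
    intro i j
    by_cases hij : i = j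
    · subst hij
      rw [hNd]
      exact mul_nonneg hs (by linarith [hbi i, neg_abs_le (M i i)])
    · rw [hNo i j hij]
      exact mul_nonneg hs (hM i j hij)
  have hexp : NormedSpace.exp (s • M) = Real.exp (-(s * b)) • NormedSpace.exp N := by
    have h1 : s • M = N + (-(s * b)) • (1 : Matrix I I ℝ) := by
      rw [hNdef, smul_add, smul_smul, neg_smul]; abel
    rw [h1, Matrix.exp_add_of_commute _ _ ((Commute.one_right N).smul_right _)]
    have h2 : NormedSpace.exp ((-(s * b)) • (1 : Matrix I I ℝ))
        = Real.exp (-(s * b)) • (1 : Matrix I I ℝ) := by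
      rw [← Algebra.algebraMap_eq_smul_one, ← Algebra.algebraMap_eq_smul_one, Real.exp_eq_exp_ℝ]
      exact (NormedSpace.algebraMap_exp_comm (𝕂 := ℝ) (𝔸 := Matrix I I ℝ) (-(s * b))).symm
    rw [h2, mul_smul_comm, mul_one]
  refine ⟨Real.exp (-(s * b)), Real.exp_pos _, fun i j => ⟨fun hij => ?_, fun hij => ?_⟩⟩
  · rw [hexp, Matrix.smul_apply, smul_eq_mul]
    refine mul_le_mul_of_nonneg_left ?_ (Real.exp_pos _).le
    have := one_add_le_exp_apply hN i j
    rwa [Matrix.one_apply_ne hij, zero_add, hNo i j hij] at this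
  · subst hij
    rw [hexp, Matrix.smul_apply, smul_eq_mul]
    refine le_mul_of_one_le_right (Real.exp_pos _).le ?_
    have := one_add_le_exp_apply hN i i
    rw [Matrix.one_apply_eq] at this
    linarith [hN i i]

theorem exp_smul_apply_nonneg {M : Matrix I I ℝ} (hM : ∀ i j, i ≠ j → 0 ≤ M i j) {s : ℝ}
    (hs : 0 ≤ s) (i j : I) : 0 ≤ NormedSpace.exp (s • M) i j := by
  obtain ⟨c, hc, H⟩ := exists_le_exp_smul_apply hM hs
  by_cases hij : i = j
  · exact hc.le.trans ((H i j).2 hij)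
  · exact (mul_nonneg hc.le (mul_nonneg hs (hM i j hij))).trans ((H i j).1 hij)

theorem exp_smul_apply_self_pos {M : Matrix I I ℝ} (hM : ∀ i j, i ≠ j → 0 ≤ M i j) {s : ℝ}
    (hs : 0 ≤ s) (i : I) : 0 < NormedSpace.exp (s • M) i i := by
  obtain ⟨c, hc, H⟩ := exists_le_exp_smul_apply hM hs
  exact hc.trans_le ((H i i).2 rfl)

theorem exp_smul_apply_pos {M : Matrix I I ℝ} (hM : ∀ i j, i ≠ j → 0 ≤ M i j) {s : ℝ}
    (hs : 0 < s) {i j : I} (hij : i ≠ j) (h : 0 < M i j) : 0 < NormedSpace.exp (s • M) i j := by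
  obtain ⟨c, hc, H⟩ := exists_le_exp_smul_apply hM hs.le
  exact (mul_pos hc (mul_pos hs h)).trans_le ((H i j).1 hij)

/-! ### Product approximation of the exponential -/

theorem norm_pow_sub_pow_le {R : Type*} [NormedRing R] [NormOneClass R] {A B : R} {K : ℝ}
    (hA : ‖A‖ ≤ K) (hB : ‖B‖ ≤ K) (hK : 1 ≤ K) (m : ℕ) :
    ‖A ^ m - B ^ m‖ ≤ m * ‖A - B‖ * K ^ m := by
  induction m with
  | zero => simp
  | succ m ih =>
    have h1 : A ^ (m + 1) - B ^ (m + 1) = (A ^ m - B ^ m) * A + B ^ m * (A - B) := by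
      rw [pow_succ, pow_succ]; noncomm_ring
    have h2 : ‖B ^ m‖ ≤ K ^ m := (norm_pow_le B m).trans (pow_le_pow_left₀ (norm_nonneg _) hB m)
    have hKm : 0 ≤ K ^ m := by positivity
    calc ‖A ^ (m + 1) - B ^ (m + 1)‖
        ≤ ‖A ^ m - B ^ m‖ * ‖A‖ + ‖B ^ m‖ * ‖A - B‖ := by
          rw [h1]
          exact (norm_add_le _ _).trans (add_le_add (norm_mul_le _ _) (norm_mul_le _ _))
      _ ≤ (m * ‖A - B‖ * K ^ m) * K + (K ^ m * K) * ‖A - B‖ := by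
          gcongr
          exact h2.trans (le_mul_of_one_le_right hKm hK)
      _ = (m + 1 : ℕ) * ‖A - B‖ * K ^ (m + 1) := by push_cast; ring

/-- A curve tangent to `exp (s • G)` at `s = 0` has the same limits of powers. -/
theorem tendsto_pow_exp_of_normedRing {R : Type*} [NormedRing R] [NormOneClass R]
    [NormedAlgebra ℝ R] [CompleteSpace R] {A : ℝ → R} {G : R} (hA0 : A 0 = 1)
    (hA : HasDerivAt A G 0) {δ : ℕ → ℝ} {m : ℕ → ℕ} {τ : ℝ} (hδ : ∀ n, 0 ≤ δ n)
    (hδ0 : Tendsto δ atTop (𝓝 0)) (hm : Tendsto (fun n => m n * δ n) atTop (𝓝 τ)) :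
    Tendsto (fun n => A (δ n) ^ m n) atTop (𝓝 (NormedSpace.exp (τ • G))) := by
  let +nondep : NormedAlgebra ℚ R := NormedAlgebra.restrictScalars ℚ ℝ R
  set B : ℝ → R := fun s => NormedSpace.exp (s • G)
  have hB0 : B 0 = 1 := by simp [B]
  have hB : HasDerivAt B G 0 := by simpa [B] using hasDerivAt_exp_smul_const (𝕂 := ℝ) G (0 : ℝ)
  have hBpow : ∀ n, B (δ n) ^ m n = B (m n * δ n) := by
    intro n
    simp only [B]
    rw [← NormedSpace.exp_nsmul, ← Nat.cast_smul_eq_nsmul ℝ, smul_smul]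
  have hBlim : Tendsto (fun n => B (δ n) ^ m n) atTop (𝓝 (B τ)) := by
    simp_rw [hBpow]
    exact (hasDerivAt_exp_smul_const (𝕂 := ℝ) G τ).continuousAt.tendsto.comp hm
  -- both curves satisfy `‖·‖ ≤ 1 + c δ` near `0`
  have hbound : ∀ C : ℝ → R, C 0 = 1 → HasDerivAt C G 0 →
      ∀ᶠ n in atTop, ‖C (δ n)‖ ≤ Real.exp ((‖G‖ + 1) * δ n) := by
    intro C hC0 hC
    have h1 := (hasDerivAt_iff_isLittleO.1 hC).def (c := 1) one_pos
    filter_upwards [hδ0.eventually h1] with n hn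
    simp only [sub_zero, hC0, Real.norm_eq_abs, abs_of_nonneg (hδ n), one_mul] at hn
    have h2 : C (δ n) = (C (δ n) - 1 - δ n • G) + (1 + δ n • G) := by abel
    calc ‖C (δ n)‖ ≤ ‖C (δ n) - 1 - δ n • G‖ + ‖1 + δ n • G‖ := by
          conv_lhs => rw [h2]
          exact norm_add_le _ _
      _ ≤ δ n + (1 + δ n * ‖G‖) := by
          refine add_le_add hn ((norm_add_le _ _).trans ?_)
          rw [norm_one, norm_smul, Real.norm_eq_abs, abs_of_nonneg (hδ n)]
      _ = (‖G‖ + 1) * δ n + 1 := by ring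
      _ ≤ _ := Real.add_one_le_exp _
  have hdiff : Tendsto (fun n => A (δ n) ^ m n - B (δ n) ^ m n) atTop (𝓝 0) := by
    rw [Metric.tendsto_nhds]
    intro ε hε
    set L : ℝ := Real.exp ((‖G‖ + 1) * (|τ| + 1))
    have hL : 0 < L := Real.exp_pos _
    set c : ℝ := ε / (2 * ((|τ| + 1) * L))
    have hτ : 0 < |τ| + 1 := by positivity
    have hc : 0 < c := by positivity
    have h1 := (hasDerivAt_iff_isLittleO.1 (hA.sub hB)).def (c := c) hc
    filter_upwards [hδ0.eventually h1, hbound A hA0 hA, hbound B hB0 hB,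
      hm.eventually (eventually_le_nhds (show τ < |τ| + 1 by linarith [le_abs_self τ]))]
      with n hn hAn hBn hmn
    simp only [Pi.sub_apply, sub_self, smul_zero, sub_zero, hA0, hB0, Real.norm_eq_abs,
      abs_of_nonneg (hδ n)] at hn
    have hK : 1 ≤ Real.exp ((‖G‖ + 1) * δ n) :=
      Real.one_le_exp (mul_nonneg (by positivity) (hδ n))
    have hKm : Real.exp ((‖G‖ + 1) * δ n) ^ m n ≤ L := by
      rw [← Real.exp_nat_mul]
      refine Real.exp_le_exp.2 ?_
      calc (m n : ℝ) * ((‖G‖ + 1) * δ n) = (‖G‖ + 1) * (m n * δ n) := by ring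
        _ ≤ _ := by gcongr
    rw [dist_zero_right]
    calc ‖A (δ n) ^ m n - B (δ n) ^ m n‖
        ≤ m n * ‖A (δ n) - B (δ n)‖ * Real.exp ((‖G‖ + 1) * δ n) ^ m n :=
          norm_pow_sub_pow_le hAn hBn hK _
      _ ≤ m n * (c * δ n) * L := by
          have h0 : 0 ≤ m n * (c * δ n) :=
            mul_nonneg (Nat.cast_nonneg _) (mul_nonneg hc.le (hδ n))
          gcongr
      _ = (m n * δ n) * (c * L) := by ring
      _ ≤ (|τ| + 1) * (c * L) := by gcongr
      _ = ε / 2 := by simp only [c]; field_simp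
      _ < ε := by linarith
  have := hdiff.add hBlim
  simpa using this

theorem tendsto_pow_exp {A : ℝ → Matrix I I ℝ} {G : Matrix I I ℝ} (hA0 : A 0 = 1)
    (hA : HasDerivAt A G 0) {δ : ℕ → ℝ} {m : ℕ → ℕ} {τ : ℝ} (hδ : ∀ n, 0 ≤ δ n)
    (hδ0 : Tendsto δ atTop (𝓝 0)) (hm : Tendsto (fun n => m n * δ n) atTop (𝓝 τ)) :
    Tendsto (fun n => A (δ n) ^ m n) atTop (𝓝 (NormedSpace.exp (τ • G))) := by
  cases isEmpty_or_nonempty I with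
  | inl _ => exact tendsto_const_nhds.congr fun n => Subsingleton.elim _ _
  | inr _ =>
    have : NormOneClass (Matrix I I ℝ) := Matrix.linfty_opNormOneClass
    exact tendsto_pow_exp_of_normedRing hA0 hA hδ hδ0 hm

end MatrixExp

/-! ### The flow on a level set as a normalized linear flow -/

section Flow

variable {I O : Type*}

theorem levelInd_apply_of_eq {h : I → O} {a : O} {i : I} (hi : h i = a) : levelInd h a i = 1 := by
  simp [levelInd, hi]

theorem levelInd_apply_of_ne {h : I → O} {a : O} {i : I} (hi : h i ≠ a) : levelInd h a i = 0 := by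
  simp [levelInd, hi]

/-- Nonnegative vectors supported in the level set `h⁻¹(a)`. -/
def levelCone (h : I → O) (a : O) : Set (I → ℝ) :=
  {x | (∀ i, 0 ≤ x i) ∧ ∀ i, h i ≠ a → x i = 0}

theorem levelInd_mul_of_support {h : I → O} {a : O} {x : I → ℝ} (hx : ∀ i, h i ≠ a → x i = 0) :
    levelInd h a * x = x := by
  ext i
  by_cases hi : h i = a
  · simp [levelInd_apply_of_eq hi]
  · simp [hx i hi]

theorem levelInd_mul_mem_levelCone {h : I → O} {a : O} {x : I → ℝ}
    (hx : ∀ i, h i = a → 0 ≤ x i) : levelInd h a * x ∈ levelCone h a := by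
  constructor
  · intro i
    by_cases hi : h i = a
    · simpa [levelInd_apply_of_eq hi] using hx i hi
    · simp [levelInd_apply_of_ne hi]
  · intro i hi
    simp [levelInd_apply_of_ne hi]

variable [Fintype I]

/-- The vector divided by its total mass; a vector of mass zero is sent to zero. -/
def normalize (x : I → ℝ) : I → ℝ := (∑ i, x i)⁻¹ • x

theorem dotProduct_levelInd (h : I → O) (a : O) (x : I → ℝ) :
    x ⬝ᵥ levelInd h a = ∑ i, (levelInd h a * x) i := by
  simp [dotProduct, mul_comm]

theorem levelSimplex_subset_levelCone {h : I → O} {a : O} {x : I → ℝ}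
    (hx : x ∈ levelSimplex h a) : x ∈ levelCone h a := ⟨hx.1.1, hx.2⟩

theorem sum_eq_one_of_mem_levelSimplex {h : I → O} {a : O} {x : I → ℝ}
    (hx : x ∈ levelSimplex h a) : ∑ i, x i = 1 := hx.1.2

theorem normalize_smul {c : ℝ} (hc : c ≠ 0) (x : I → ℝ) : normalize (c • x) = normalize x := by
  have : (c * ∑ i, x i)⁻¹ * c = (∑ i, x i)⁻¹ := by
    rw [mul_inv, mul_comm c⁻¹, mul_assoc, inv_mul_cancel₀ hc, mul_one]
  simp only [normalize, Pi.smul_apply, smul_eq_mul, ← Finset.mul_sum, smul_smul, this]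

theorem normalize_of_sum_eq_one {x : I → ℝ} (hx : ∑ i, x i = 1) : normalize x = x := by
  simp [normalize, hx]

theorem normalize_mem_levelSimplex {h : I → O} {a : O} {x : I → ℝ} (hx : x ∈ levelCone h a)
    (hpos : 0 < ∑ i, x i) : normalize x ∈ levelSimplex h a := by
  refine ⟨⟨fun i => ?_, ?_⟩, fun i hi => ?_⟩
  · exact mul_nonneg (inv_nonneg.2 hpos.le) (hx.1 i)
  · simp only [normalize, Pi.smul_apply, smul_eq_mul, ← Finset.mul_sum]
    exact inv_mul_cancel₀ hpos.ne'
  · simp [normalize, hx.2 i hi]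

theorem opH_eq_normalize {h : I → O} {ν : O → I → ℝ} {a : O} {x : I → ℝ}
    (hx : ∑ i, (levelInd h a * x) i ≠ 0) : opH h ν a x = normalize (levelInd h a * x) := by
  rw [opH, dotProduct_levelInd, if_pos hx, normalize]

theorem opH_mem_levelSimplex {h : I → O} {ν : O → I → ℝ} (hν : ∀ a, ν a ∈ levelSimplex h a)
    {a : O} {x : I → ℝ} (hx : ∀ i, h i = a → 0 ≤ x i) : opH h ν a x ∈ levelSimplex h a := by
  by_cases h0 : ∑ i, (levelInd h a * x) i = 0
  · rw [opH, dotProduct_levelInd, if_neg (not_not.2 h0)]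
    exact hν a
  · rw [opH_eq_normalize h0]
    have h1 := levelInd_mul_mem_levelCone hx
    exact normalize_mem_levelSimplex h1
      (lt_of_le_of_ne (Finset.sum_nonneg fun i _ => h1.1 i) (Ne.symm h0))

theorem vecMul_apply_nonneg_of_ne {Λ : Matrix I I ℝ} (hΛ : IsRateMatrix Λ) {h : I → O} {a b : O}
    (hab : a ≠ b) {x : I → ℝ} (hx : x ∈ levelCone h a) {i : I} (hi : h i = b) :
    0 ≤ (x ᵥ* Λ) i := by
  refine Finset.sum_nonneg fun k _ => ?_
  by_cases hk : h k = a
  · refine mul_nonneg (hx.1 k) (hΛ.1 k i ?_)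
    rintro rfl
    exact hab (hk.symm.trans hi)
  · simp [hx.2 k hk]

theorem vecMul_apply_pos {x : I → ℝ} {N : Matrix I I ℝ} {i : I} (hx : ∀ k, 0 ≤ x k)
    (hN : ∀ k, 0 ≤ N k i) {k : I} (hk : 0 < x k) (hki : 0 < N k i) : 0 < (x ᵥ* N) i :=
  Finset.sum_pos' (fun j _ => mul_nonneg (hx j) (hN j)) ⟨k, Finset.mem_univ k, mul_pos hk hki⟩

/-- The nonlinear vector field is locally Lipschitz, being quadratic. -/
theorem exists_lipschitzOnWith_field (Λ : Matrix I I ℝ) (h : I → O) (a : O) (R : ℝ) :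
    ∃ K : ℝ≥0, LipschitzOnWith K (field Λ h a) (Metric.closedBall 0 R) := by
  have hc : ContDiff ℝ 1 (field Λ h a) := by
    rw [contDiff_pi]
    intro i
    simp only [field, Matrix.vecMul, dotProduct, Pi.sub_apply, Pi.mul_apply, Pi.smul_apply,
      smul_eq_mul]
    fun_prop
  exact hc.locallyLipschitz.locallyLipschitzOn.exists_lipschitzOnWith_of_compact
    (isCompact_closedBall 0 R)

theorem continuous_field (Λ : Matrix I I ℝ) (h : I → O) (a : O) : Continuous (field Λ h a) := by
  unfold field
  fun_prop

variable [DecidableEq I]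

/-- The block `D Λ D` of `Λ` on the level set `h⁻¹(a)`, where `D` is the diagonal matrix with
entries `1_{h⁻¹(a)}`. -/
def levelMatrix (Λ : Matrix I I ℝ) (h : I → O) (a : O) : Matrix I I ℝ :=
  Matrix.diagonal (levelInd h a) * Λ * Matrix.diagonal (levelInd h a)

theorem levelMatrix_apply (Λ : Matrix I I ℝ) (h : I → O) (a : O) (i j : I) :
    levelMatrix Λ h a i j = levelInd h a i * Λ i j * levelInd h a j := by
  simp [levelMatrix, Matrix.mul_diagonal, Matrix.diagonal_mul]

theorem levelMatrix_nonneg {Λ : Matrix I I ℝ} (hΛ : IsRateMatrix Λ) (h : I → O) (a : O)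
    (i j : I) (hij : i ≠ j) : 0 ≤ levelMatrix Λ h a i j := by
  have hind : ∀ k, 0 ≤ levelInd h a k := fun k =>
    Set.indicator_apply_nonneg fun _ => zero_le_one
  rw [levelMatrix_apply]
  exact mul_nonneg (mul_nonneg (hind i) (hΛ.1 i j hij)) (hind j)

theorem vecMul_diagonal_levelInd (h : I → O) (a : O) (x : I → ℝ) :
    x ᵥ* Matrix.diagonal (levelInd h a) = levelInd h a * x := by
  ext i
  simp [Matrix.vecMul_diagonal, mul_comm]

theorem vecMul_levelMatrix {Λ : Matrix I I ℝ} {h : I → O} {a : O} {x : I → ℝ}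
    (hx : ∀ i, h i ≠ a → x i = 0) : x ᵥ* levelMatrix Λ h a = levelInd h a * (x ᵥ* Λ) := by
  rw [levelMatrix, ← Matrix.vecMul_vecMul, ← Matrix.vecMul_vecMul, vecMul_diagonal_levelInd,
    vecMul_diagonal_levelInd, levelInd_mul_of_support hx]

/-- The exponential of the block commutes with the projection to the level set. -/
theorem vecMul_exp_levelMatrix_support {Λ : Matrix I I ℝ} {h : I → O} {a : O} {x : I → ℝ}
    (hx : ∀ i, h i ≠ a → x i = 0) (s : ℝ) (i : I) (hi : h i ≠ a) :
    (x ᵥ* NormedSpace.exp (s • levelMatrix Λ h a)) i = 0 := by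
  have hD : Matrix.diagonal (levelInd h a) * Matrix.diagonal (levelInd h a)
      = Matrix.diagonal (levelInd h a) := by
    rw [Matrix.diagonal_mul_diagonal]
    congr 1
    ext j
    by_cases hj : h j = a
    · simp [levelInd_apply_of_eq hj]
    · simp [levelInd_apply_of_ne hj]
  have hcomm : Commute (Matrix.diagonal (levelInd h a)) (levelMatrix Λ h a) := by
    rw [Commute, SemiconjBy, levelMatrix]
    conv_rhs => rw [mul_assoc, hD]
    rw [← mul_assoc, ← mul_assoc, hD]
  have hcomm' := (hcomm.smul_right s).exp_right
  have hxD : x ᵥ* Matrix.diagonal (levelInd h a) = x := by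
    rw [vecMul_diagonal_levelInd, levelInd_mul_of_support hx]
  rw [← hxD, Matrix.vecMul_vecMul, hcomm'.eq, ← Matrix.vecMul_vecMul, vecMul_diagonal_levelInd]
  simp [levelInd_apply_of_ne hi]

theorem vecMul_exp_mem_levelCone {Λ : Matrix I I ℝ} (hΛ : IsRateMatrix Λ) {h : I → O} {a : O}
    {x : I → ℝ} (hx : x ∈ levelCone h a) {s : ℝ} (hs : 0 ≤ s) :
    x ᵥ* NormedSpace.exp (s • levelMatrix Λ h a) ∈ levelCone h a :=
  ⟨fun i => Finset.sum_nonneg fun k _ =>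
    mul_nonneg (hx.1 k) (exp_smul_apply_nonneg (levelMatrix_nonneg hΛ h a) hs k i),
    vecMul_exp_levelMatrix_support hx.2 s⟩

theorem vecMul_exp_apply_pos_self {Λ : Matrix I I ℝ} (hΛ : IsRateMatrix Λ) {h : I → O} {a : O}
    {x : I → ℝ} (hx : x ∈ levelCone h a) {s : ℝ} (hs : 0 ≤ s) {i : I} (hi : 0 < x i) :
    0 < (x ᵥ* NormedSpace.exp (s • levelMatrix Λ h a)) i :=
  vecMul_apply_pos hx.1 (fun k => exp_smul_apply_nonneg (levelMatrix_nonneg hΛ h a) hs k i) hi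
    (exp_smul_apply_self_pos (levelMatrix_nonneg hΛ h a) hs i)

theorem vecMul_exp_apply_pos {Λ : Matrix I I ℝ} (hΛ : IsRateMatrix Λ) {h : I → O} {a : O}
    {x : I → ℝ} (hx : x ∈ levelCone h a) {s : ℝ} (hs : 0 < s) {i j : I} (hi : 0 < x i)
    (hia : h i = a) (hja : h j = a) (hij : i ≠ j) (hΛij : 0 < Λ i j) :
    0 < (x ᵥ* NormedSpace.exp (s • levelMatrix Λ h a)) j := by
  refine vecMul_apply_pos hx.1
    (fun k => exp_smul_apply_nonneg (levelMatrix_nonneg hΛ h a) hs.le k j) hi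
    (exp_smul_apply_pos (levelMatrix_nonneg hΛ h a) hs hij ?_)
  rwa [levelMatrix_apply, levelInd_apply_of_eq hia, levelInd_apply_of_eq hja, one_mul, mul_one]

theorem sum_vecMul_exp_pos {Λ : Matrix I I ℝ} (hΛ : IsRateMatrix Λ) {h : I → O} {a : O}
    {x : I → ℝ} (hx : x ∈ levelCone h a) (hpos : 0 < ∑ i, x i) {s : ℝ} (hs : 0 ≤ s) :
    0 < ∑ i, (x ᵥ* NormedSpace.exp (s • levelMatrix Λ h a)) i := by
  obtain ⟨i, hi⟩ : ∃ i, 0 < x i := by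
    by_contra! hcon
    exact hpos.not_ge (Finset.sum_nonpos fun i _ => hcon i)
  exact Finset.sum_pos' (fun j _ => (vecMul_exp_mem_levelCone hΛ hx hs).1 j)
    ⟨i, Finset.mem_univ i, vecMul_exp_apply_pos_self hΛ hx hs hi⟩

/-- The curve `t ↦ x e^{tDΛD} / (x e^{tDΛD} 1)`, which solves `y' = F_a(y)`. -/
def flow (Λ : Matrix I I ℝ) (h : I → O) (a : O) (x : I → ℝ) (s : ℝ) : I → ℝ :=
  normalize (x ᵥ* NormedSpace.exp (s • levelMatrix Λ h a))

theorem flow_mem_levelSimplex {Λ : Matrix I I ℝ} (hΛ : IsRateMatrix Λ) {h : I → O} {a : O}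
    {x : I → ℝ} (hx : x ∈ levelSimplex h a) {s : ℝ} (hs : 0 ≤ s) :
    flow Λ h a x s ∈ levelSimplex h a :=
  normalize_mem_levelSimplex (vecMul_exp_mem_levelCone hΛ (levelSimplex_subset_levelCone hx) hs)
    (sum_vecMul_exp_pos hΛ (levelSimplex_subset_levelCone hx)
      (by rw [sum_eq_one_of_mem_levelSimplex hx]; exact one_pos) hs)

theorem isFlowCurve_flow {Λ : Matrix I I ℝ} (hΛ : IsRateMatrix Λ) {h : I → O} {a : O}
    {x : I → ℝ} (hx : x ∈ levelSimplex h a) : IsFlowCurve Λ h a x (flow Λ h a x) := by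
  have hx' := levelSimplex_subset_levelCone hx
  constructor
  · simp [flow, normalize_of_sum_eq_one (sum_eq_one_of_mem_levelSimplex hx)]
  intro t ht
  refine HasDerivAt.hasDerivWithinAt ?_
  set ρ : ℝ → I → ℝ := fun s => x ᵥ* NormedSpace.exp (s • levelMatrix Λ h a) with hρ
  have hd : HasDerivAt ρ (ρ t ᵥ* levelMatrix Λ h a) t := hasDerivAt_vecMul_exp_smul _ x t
  have hpos : 0 < ∑ i, ρ t i := sum_vecMul_exp_pos hΛ hx'
    (by rw [sum_eq_one_of_mem_levelSimplex hx]; exact one_pos) ht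
  have hsupp : ∀ i, h i ≠ a → ρ t i = 0 := vecMul_exp_levelMatrix_support hx'.2 t
  have hsum : HasDerivAt (fun s => ∑ i, ρ s i) (∑ i, (ρ t ᵥ* levelMatrix Λ h a) i) t :=
    HasDerivAt.fun_sum fun i _ => (hasDerivAt_pi.1 hd) i
  have hmain := (hsum.inv hpos.ne').smul hd
  refine hmain.congr_deriv ?_
  have hflow : flow Λ h a x t = (∑ i, ρ t i)⁻¹ • ρ t := rfl
  rw [hflow, field, Matrix.smul_vecMul, smul_dotProduct, dotProduct_levelInd,
    ← vecMul_levelMatrix hsupp]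
  ext i
  simp only [Pi.add_apply, Pi.sub_apply, Pi.smul_apply, Pi.mul_apply, smul_eq_mul]
  have h1 : levelInd h a i * ((∑ i, ρ t i)⁻¹ * (ρ t ᵥ* Λ) i)
      = (∑ i, ρ t i)⁻¹ * (ρ t ᵥ* levelMatrix Λ h a) i := by
    rw [vecMul_levelMatrix hsupp, Pi.mul_apply]; ring
  rw [h1]
  simp only [Pi.inv_apply]
  field_simp
  ring

end Flow

/-! ### Jump times of step paths -/

section JumpTimes

variable {O : Type*}

/-- A path which is locally constant to the right of every time and eventually constant to the
left of every time: a cadlag path in a discrete space. -/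
def IsStepPath (y : ℝ≥0 → O) : Prop :=
  ∀ t, (∀ᶠ s in 𝓝[≥] t, y s = y t) ∧ ∃ a, ∀ᶠ s in 𝓝[<] t, y s = a

theorem IsCadlag.isStepPath [TopologicalSpace O] [DiscreteTopology O] {y : ℝ≥0 → O}
    (hy : IsCadlag y) : IsStepPath y := by
  intro t
  obtain ⟨h1, l, h2⟩ := hy t
  refine ⟨?_, l, ?_⟩
  · simpa [ContinuousWithinAt, nhds_discrete] using h1
  · simpa [nhds_discrete] using h2

theorem IsStepPath.comp {S : Type*} {x : ℝ≥0 → S} (hx : IsStepPath x) (h : S → O) :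
    IsStepPath fun t => h (x t) := by
  intro t
  obtain ⟨h1, a, h2⟩ := hx t
  exact ⟨h1.mono fun s hs => congrArg h hs, h a, h2.mono fun s hs => congrArg h hs⟩

theorem jumpTime_zero (y : ℝ≥0 → O) : jumpTime y 0 = 0 := rfl

theorem jumpTime_succ (y : ℝ≥0 → O) (j : ℕ) :
    jumpTime y (j + 1) = sInf {s : ℝ≥0∞ | ∃ t : ℝ≥0, s = (t : ℝ≥0∞) ∧
      jumpTime y j < (t : ℝ≥0∞) ∧ y t ≠ y (jumpTime y j).toNNReal} := rfl

theorem jumpTime_le_succ (y : ℝ≥0 → O) (j : ℕ) : jumpTime y j ≤ jumpTime y (j + 1) := by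
  rw [jumpTime_succ]
  refine le_sInf ?_
  rintro s ⟨t, rfl, ht, -⟩
  exact ht.le

theorem monotone_jumpTime (y : ℝ≥0 → O) : Monotone (jumpTime y) :=
  monotone_nat_of_le_succ (jumpTime_le_succ y)

theorem eq_of_jumpTime_le_of_lt {y : ℝ≥0 → O} {j : ℕ} {t : ℝ≥0} (h1 : jumpTime y j ≤ t)
    (h2 : (t : ℝ≥0∞) < jumpTime y (j + 1)) : y t = y (jumpTime y j).toNNReal := by
  rcases h1.eq_or_lt with h | h
  · rw [h, ENNReal.toNNReal_coe]
  · by_contra hne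
    rw [jumpTime_succ] at h2
    exact h2.not_ge (sInf_le ⟨t, rfl, h, hne⟩)

theorem IsStepPath.exists_gap {y : ℝ≥0 → O} (hy : IsStepPath y) (t : ℝ≥0) :
    ∃ u > t, ∀ s, t ≤ s → s < u → y s = y t := by
  obtain ⟨u, hu, h⟩ := (mem_nhdsGE_iff_exists_Ico_subset).1 (hy t).1
  exact ⟨u, hu, fun s h1 h2 => h ⟨h1, h2⟩⟩

theorem IsStepPath.exists_gap_left {y : ℝ≥0 → O} (hy : IsStepPath y) {t : ℝ≥0} (ht : 0 < t) :
    ∃ a, ∃ u < t, ∀ s, u < s → s < t → y s = a := by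
  obtain ⟨a, ha⟩ := (hy t).2
  obtain ⟨u, hu, h⟩ := (mem_nhdsLT_iff_exists_Ioo_subset' ht).1 ha
  exact ⟨a, u, hu, fun s h1 h2 => h ⟨h1, h2⟩⟩

theorem IsStepPath.jumpTime_lt_succ {y : ℝ≥0 → O} (hy : IsStepPath y) {j : ℕ}
    (hj : jumpTime y j ≠ ∞) : jumpTime y j < jumpTime y (j + 1) := by
  obtain ⟨u, hu, h⟩ := hy.exists_gap (jumpTime y j).toNNReal
  have hu' : jumpTime y j < u := by
    rw [← ENNReal.coe_toNNReal hj]; exact_mod_cast hu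
  refine hu'.trans_le ?_
  rw [jumpTime_succ]
  refine le_sInf ?_
  rintro s ⟨t, rfl, ht, hne⟩
  by_contra hlt
  refine hne (h t ?_ ?_)
  · rw [← ENNReal.coe_le_coe, ENNReal.coe_toNNReal hj]; exact ht.le
  · exact_mod_cast not_le.1 hlt

theorem IsStepPath.apply_jumpTime_succ_ne {y : ℝ≥0 → O} (hy : IsStepPath y) {j : ℕ}
    (hj : jumpTime y (j + 1) ≠ ∞) :
    y (jumpTime y (j + 1)).toNNReal ≠ y (jumpTime y j).toNNReal := by
  intro heq
  obtain ⟨u, hu, h⟩ := hy.exists_gap (jumpTime y (j + 1)).toNNReal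
  have hu' : jumpTime y (j + 1) < u := by
    rw [← ENNReal.coe_toNNReal hj]; exact_mod_cast hu
  have hu2 := hu'
  conv_lhs at hu2 => rw [jumpTime_succ]
  obtain ⟨s, ⟨t, rfl, ht, hne⟩, hlt⟩ := sInf_lt_iff.1 hu2
  have hle : jumpTime y (j + 1) ≤ t := by
    rw [jumpTime_succ]
    exact sInf_le ⟨t, rfl, ht, hne⟩
  refine hne ((h t ?_ (by exact_mod_cast hlt)).trans heq)
  rw [← ENNReal.coe_le_coe, ENNReal.coe_toNNReal hj]; exact hle

/-- The jump times of a step path do not accumulate. -/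
theorem IsStepPath.exists_lt_jumpTime {y : ℝ≥0 → O} (hy : IsStepPath y) (t : ℝ≥0) :
    ∃ j, (t : ℝ≥0∞) < jumpTime y j := by
  by_contra! hcon
  have hfin : ∀ j, jumpTime y j ≠ ∞ := fun j => ((hcon j).trans_lt ENNReal.coe_lt_top).ne
  set T : ℕ → ℝ≥0 := fun j => (jumpTime y j).toNNReal
  have hT : ∀ j, (T j : ℝ≥0∞) = jumpTime y j := fun j => ENNReal.coe_toNNReal (hfin j)
  have hmono : StrictMono T := strictMono_nat_of_lt_succ fun j => by
    rw [← ENNReal.coe_lt_coe, hT, hT]; exact hy.jumpTime_lt_succ (hfin j)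
  have hbdd : BddAbove (Set.range T) := ⟨t, by
    rintro _ ⟨j, rfl⟩
    rw [← ENNReal.coe_le_coe, hT]; exact hcon j⟩
  have hlim := tendsto_atTop_ciSup hmono.monotone hbdd
  have hlt : ∀ j, T j < ⨆ j, T j := fun j => (hmono j.lt_succ_self).trans_le (le_ciSup hbdd _)
  obtain ⟨a, ha⟩ := (hy (⨆ j, T j)).2
  have hev : ∀ᶠ j in atTop, y (T j) = a :=
    (tendsto_nhdsWithin_iff.2 ⟨hlim, Eventually.of_forall hlt⟩).eventually ha
  obtain ⟨N, hN⟩ := eventually_atTop.1 hev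
  exact hy.apply_jumpTime_succ_ne (hfin (N + 1)) ((hN (N + 1) (by lia)).trans (hN N le_rfl).symm)

/-- The number of jumps of the path up to time `t`. For a step path the set is bounded, so that the
supremum is attained. -/
def jumpCount (y : ℝ≥0 → O) (t : ℝ≥0) : ℕ := sSup {j | jumpTime y j ≤ t}

theorem IsStepPath.jumpCount_spec {y : ℝ≥0 → O} (hy : IsStepPath y) (t : ℝ≥0) :
    jumpTime y (jumpCount y t) ≤ t ∧ (t : ℝ≥0∞) < jumpTime y (jumpCount y t + 1) := by
  obtain ⟨N, hN⟩ := hy.exists_lt_jumpTime t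
  have hbdd : BddAbove {j | jumpTime y j ≤ t} := ⟨N, fun j hj => by
    by_contra! hlt
    exact (hN.trans_le (monotone_jumpTime y hlt.le)).not_ge hj⟩
  refine ⟨Nat.sSup_mem ⟨0, by simp [jumpTime_zero]⟩ hbdd, ?_⟩
  by_contra! hle
  exact (Nat.lt_succ_self _).not_ge (le_csSup hbdd hle)

theorem jumpTime_le_iff_of_mem {y : ℝ≥0 → O} {j k : ℕ} {t : ℝ≥0} (h1 : jumpTime y j ≤ t)
    (h2 : (t : ℝ≥0∞) < jumpTime y (j + 1)) : jumpTime y k ≤ t ↔ k ≤ j := by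
  constructor
  · intro hk
    by_contra! hlt
    exact (h2.trans_le (monotone_jumpTime y hlt)).not_ge hk
  · intro hk
    exact (monotone_jumpTime y hk).trans h1

theorem IsStepPath.jumpCount_eq {y : ℝ≥0 → O} (hy : IsStepPath y) {j : ℕ} {t : ℝ≥0}
    (h1 : jumpTime y j ≤ t) (h2 : (t : ℝ≥0∞) < jumpTime y (j + 1)) : jumpCount y t = j := by
  obtain ⟨h3, h4⟩ := hy.jumpCount_spec t
  exact le_antisymm ((jumpTime_le_iff_of_mem h1 h2).1 h3) ((jumpTime_le_iff_of_mem h3 h4).1 h1)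

end JumpTimes

/-! ### Cadlag functions -/

section Cadlag

variable {E : Type*} [NormedAddCommGroup E]

theorem IsCadlag.isBounded_image {f : ℝ≥0 → E} (hf : IsCadlag f) (t : ℝ≥0) :
    Bornology.IsBounded (f '' Set.Icc 0 t) := by
  refine isCompact_Icc.induction_on (p := fun s => Bornology.IsBounded (f '' s)) (by simp)
    (fun s u hsu hu => hu.subset (Set.image_mono hsu))
    (fun s u hs hu => by rw [Set.image_union]; exact hs.union hu) fun x _ => ?_
  obtain ⟨h1, l, h2⟩ := hf x
  have key : ∀ (F : Filter ℝ≥0) (z : E), Tendsto f F (𝓝 z) →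
      ∃ s ∈ F, Bornology.IsBounded (f '' s) := fun F z hz =>
    ⟨f ⁻¹' Metric.ball z 1, hz (Metric.ball_mem_nhds z one_pos),
      Metric.isBounded_ball.subset (Set.image_preimage_subset _ _)⟩
  obtain ⟨s, hs, hbs⟩ := key _ _ h1
  obtain ⟨u, hu, hbu⟩ := key _ _ h2
  refine ⟨s ∪ u, mem_nhdsWithin_of_mem_nhds ?_, by rw [Set.image_union]; exact hbs.union hbu⟩
  rw [← nhdsLT_sup_nhdsGE]
  exact ⟨mem_of_superset hu Set.subset_union_right, mem_of_superset hs Set.subset_union_left⟩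

/-- A function on the line that is right-continuous everywhere is the limit of its right
discretizations, hence measurable. -/
theorem stronglyMeasurable_of_right_continuous [SecondCountableTopology E] {f : ℝ → E}
    (hf : ∀ t, ContinuousWithinAt f (Set.Ici t) t) : StronglyMeasurable f := by
  borelize E
  refine Measurable.stronglyMeasurable ?_
  have hg : ∀ n : ℕ, Measurable fun t : ℝ => f ((⌊(n + 1) * t⌋ + 1) / (n + 1)) := fun n =>
    (measurable_from_top (f := fun k : ℤ => f ((k + 1) / (n + 1)))).comp
      (Int.measurable_floor.comp (measurable_const.mul measurable_id))
  refine measurable_of_tendsto_metrizable hg (tendsto_pi_nhds.2 fun t => ?_)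
  refine (hf t).tendsto.comp (tendsto_nhdsWithin_iff.2 ⟨?_, Eventually.of_forall fun n => ?_⟩)
  · have h0 : Tendsto (fun n : ℕ => t + 1 / ((n : ℝ) + 1)) atTop (𝓝 (t + 0)) :=
      tendsto_const_nhds.add tendsto_one_div_add_atTop_nhds_zero_nat
    rw [add_zero] at h0
    refine tendsto_of_tendsto_of_tendsto_of_le_of_le tendsto_const_nhds h0 (fun n => ?_)
      fun n => ?_
    · have hn : (0 : ℝ) < n + 1 := by positivity
      rw [le_div_iff₀ hn, mul_comm]
      exact (Int.lt_floor_add_one _).le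
    · have hn : (0 : ℝ) < n + 1 := by positivity
      have h1 : (t + 1 / ((n : ℝ) + 1)) * (n + 1) = (n + 1) * t + 1 := by field_simp
      rw [div_le_iff₀ hn, h1]
      gcongr
      exact Int.floor_le _
  · have hn : (0 : ℝ) < n + 1 := by positivity
    rw [Set.mem_Ici, le_div_iff₀ hn, mul_comm]
    exact (Int.lt_floor_add_one _).le

theorem IsCadlag.stronglyMeasurable [SecondCountableTopology E] {f : ℝ≥0 → E}
    (hf : IsCadlag f) : StronglyMeasurable fun r : ℝ => f r.toNNReal :=
  stronglyMeasurable_of_right_continuous fun r =>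
    (hf r.toNNReal).1.comp continuous_real_toNNReal.continuousWithinAt
      fun _ hu => Real.toNNReal_mono hu

theorem IsCadlag.intervalIntegrable [NormedSpace ℝ E] [SecondCountableTopology E] {f : ℝ≥0 → E}
    (hf : IsCadlag f) (s t : ℝ) :
    IntervalIntegrable (fun r : ℝ => f r.toNNReal) volume s t := by
  obtain ⟨C, hC⟩ := (hf.isBounded_image (max s t).toNNReal).exists_norm_le
  refine (intervalIntegrable_const (c := C)).mono_fun hf.stronglyMeasurable.aestronglyMeasurable ?_
  refine (ae_restrict_iff' measurableSet_uIoc).2 (Eventually.of_forall fun r hr => ?_)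
  refine (hC _ ⟨r.toNNReal, ⟨zero_le, Real.toNNReal_mono ?_⟩, rfl⟩).trans (le_abs_self _)
  exact hr.2

end Cadlag

/-! ### The filtering equation along a step path -/

section Equation

variable {I O : Type*}

theorem jumpTime_ne_top_of_le {y : ℝ≥0 → O} {j : ℕ} {t : ℝ≥0} (h : jumpTime y j ≤ t) :
    jumpTime y j ≠ ∞ := (h.trans_lt ENNReal.coe_lt_top).ne

theorem jumpTime_ne_top_of_succ {y : ℝ≥0 → O} {j : ℕ} (h : jumpTime y (j + 1) ≠ ∞) :
    jumpTime y j ≠ ∞ := ((jumpTime_le_succ y j).trans_lt (lt_top_iff_ne_top.2 h)).ne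

theorem jumpTime_le_coe_iff {y : ℝ≥0 → O} {j : ℕ} (hj : jumpTime y j ≠ ∞) {t : ℝ≥0} :
    jumpTime y j ≤ t ↔ (jumpTime y j).toNNReal ≤ t := by
  rw [← ENNReal.coe_le_coe, ENNReal.coe_toNNReal hj]

theorem coe_lt_jumpTime_iff {y : ℝ≥0 → O} {j : ℕ} (hj : jumpTime y j ≠ ∞) {t : ℝ≥0} :
    (t : ℝ≥0∞) < jumpTime y j ↔ t < (jumpTime y j).toNNReal := by
  rw [← ENNReal.coe_lt_coe, ENNReal.coe_toNNReal hj]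

theorem IsStepPath.toNNReal_jumpTime_lt_succ {y : ℝ≥0 → O} (hy : IsStepPath y) {j : ℕ}
    (hj : jumpTime y (j + 1) ≠ ∞) :
    (jumpTime y j).toNNReal < (jumpTime y (j + 1)).toNNReal := by
  rw [← ENNReal.coe_lt_coe, ENNReal.coe_toNNReal hj,
    ENNReal.coe_toNNReal (jumpTime_ne_top_of_succ hj)]
  exact hy.jumpTime_lt_succ (jumpTime_ne_top_of_succ hj)

theorem IsStepPath.toNNReal_jumpTime_pos {y : ℝ≥0 → O} (hy : IsStepPath y) {j : ℕ}
    (hj1 : 1 ≤ j) (hj : jumpTime y j ≠ ∞) : 0 < (jumpTime y j).toNNReal := by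
  obtain ⟨k, rfl⟩ := Nat.exists_eq_add_of_le' hj1
  exact zero_le.trans_lt (hy.toNNReal_jumpTime_lt_succ hj)

theorem IsCadlag.tendsto_leftLim {E : Type*} [TopologicalSpace E] [T2Space E] {p : ℝ≥0 → E}
    (hp : IsCadlag p) {t : ℝ≥0} (ht : 0 < t) :
    Tendsto p (𝓝[<] t) (𝓝 (Function.leftLim p t)) := by
  have : (𝓝[<] t).NeBot := nhdsLT_neBot_of_exists_lt ⟨0, ht⟩
  obtain ⟨l, hl⟩ := (hp t).2
  rwa [leftLim_eq_of_tendsto hl]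

theorem IsCadlag.leftLim_congr {E : Type*} [TopologicalSpace E] [T2Space E] {p q : ℝ≥0 → E}
    (hp : IsCadlag p) {t : ℝ≥0} (ht : 0 < t) (h : ∀ s < t, p s = q s) :
    Function.leftLim p t = Function.leftLim q t := by
  have : (𝓝[<] t).NeBot := nhdsLT_neBot_of_exists_lt ⟨0, ht⟩
  exact (leftLim_eq_of_tendsto ((hp.tendsto_leftLim ht).congr'
    (eventually_nhdsWithin_of_forall h))).symm

/-- Between two jump times the sum over the past jumps in the filtering equation is a sum over
an initial segment of indices. -/
theorem finsum_jumpTime_eq {E : Type*} [AddCommMonoid E] {y : ℝ≥0 → O} {j : ℕ} {t : ℝ≥0}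
    (h1 : jumpTime y j ≤ t) (h2 : (t : ℝ≥0∞) < jumpTime y (j + 1)) (f : ℕ → E) :
    ∑ᶠ (k : ℕ) (_ : 1 ≤ k ∧ jumpTime y k ≤ t), f k = ∑ k ∈ Finset.Icc 1 j, f k := by
  rw [← finsum_mem_coe_finset]
  refine finsum_congr fun k => ?_
  rw [jumpTime_le_iff_of_mem h1 h2]
  simp

variable [Fintype I]

theorem IsCadlag.field {y : ℝ≥0 → O} (hy : IsStepPath y) {p : ℝ≥0 → I → ℝ} (hp : IsCadlag p)
    (Λ : Matrix I I ℝ) (h : I → O) : IsCadlag fun t => field Λ h (y t) (p t) := by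
  intro t
  obtain ⟨h1, a, h2⟩ := hy t
  obtain ⟨h3, l, h4⟩ := hp t
  refine ⟨?_, NoiseFreeFilter.field Λ h a l, ?_⟩
  · refine (((continuous_field Λ h (y t)).tendsto (p t)).comp h3).congr' ?_
    filter_upwards [h1] with s hs
    simp [hs]
  · refine (((continuous_field Λ h a).tendsto l).comp h4).congr' ?_
    filter_upwards [h2] with s hs
    simp [hs]

/-- The increment of the flow between two jump times is the integral of the vector field. -/
theorem integral_field_eq {Λ : Matrix I I ℝ} {h : I → O} {y : ℝ≥0 → O} (hy : IsStepPath y)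
    {p : ℝ≥0 → I → ℝ} (hp : IsCadlag p) {j : ℕ} {φ : ℝ → I → ℝ}
    (hφ : IsFlowCurve Λ h (y (jumpTime y j).toNNReal) (p (jumpTime y j).toNNReal) φ)
    (hpφ : ∀ t : ℝ≥0, jumpTime y j ≤ t → t < jumpTime y (j + 1) →
        p t = φ ((t : ℝ) - (jumpTime y j).toReal))
    {t : ℝ≥0} (h1 : jumpTime y j ≤ t) (h2 : (t : ℝ≥0∞) ≤ jumpTime y (j + 1)) :
    (∫ s in (jumpTime y j).toReal..t, field Λ h (y s.toNNReal) (p s.toNNReal))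
      = φ (t - (jumpTime y j).toReal) - p (jumpTime y j).toNNReal := by
  have hj := jumpTime_ne_top_of_le h1
  set a := (jumpTime y j).toReal with ha
  have hat : a ≤ t := by
    rw [ha, ← ENNReal.coe_toNNReal_eq_toReal]
    exact_mod_cast (jumpTime_le_coe_iff hj).1 h1
  have hcont : ContinuousOn (fun s => φ (s - a)) (Set.Icc a t) := by
    intro s hs
    refine ContinuousWithinAt.comp (t := Set.Ici 0)
      (hφ.2 (s - a) (sub_nonneg.2 hs.1)).continuousWithinAt
      (by fun_prop) fun u hu => sub_nonneg.2 hu.1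
  rw [intervalIntegral.integral_eq_sub_of_hasDeriv_right_of_le hat hcont _
    ((IsCadlag.field hy hp Λ h).intervalIntegrable a t)]
  · rw [sub_self, hφ.1]
  · intro s hs
    have hs0 : 0 ≤ s := by
      have : 0 ≤ a := ENNReal.toReal_nonneg
      linarith [hs.1]
    have hjs : jumpTime y j ≤ s.toNNReal := by
      rw [jumpTime_le_coe_iff hj, ← NNReal.coe_le_coe, ENNReal.coe_toNNReal_eq_toReal,
        Real.coe_toNNReal s hs0]
      exact hs.1.le
    have hsj : (s.toNNReal : ℝ≥0∞) < jumpTime y (j + 1) := by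
      refine lt_of_lt_of_le ?_ h2
      rw [ENNReal.coe_lt_coe, ← NNReal.coe_lt_coe, Real.coe_toNNReal s hs0]
      exact hs.2
    rw [eq_of_jumpTime_le_of_lt hjs hsj, hpφ _ hjs hsj, Real.coe_toNNReal s hs0]
    have hd := hφ.2 (s - a) (sub_nonneg.2 hs.1.le)
    have hd2 : HasDerivAt φ (field Λ h (y (jumpTime y j).toNNReal) (φ (s - a))) (s - a) :=
      hd.hasDerivAt (Ici_mem_nhds (sub_pos.2 hs.1))
    exact (hd2.comp_sub_const s a).hasDerivWithinAt

theorem solvesFilteringEq_of_followsFlowWithJumps {Λ : Matrix I I ℝ} {h : I → O}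
    {ν : O → I → ℝ} {μ : I → ℝ} {y : ℝ≥0 → O} (hy : IsStepPath y) {p : ℝ≥0 → I → ℝ}
    (hp : IsCadlag p) (hflow : FollowsFlowWithJumps Λ h ν μ y p) :
    SolvesFilteringEq Λ h ν μ y p := by
  refine ⟨hp, ?_⟩
  set G : ℝ → I → ℝ := fun s => field Λ h (y s.toNNReal) (p s.toNNReal) with hG
  have hint : ∀ a b, IntervalIntegrable G volume a b :=
    (IsCadlag.field hy hp Λ h).intervalIntegrable
  set D : ℕ → I → ℝ := fun j => opH h ν (y (jumpTime y j).toNNReal)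
    (Function.leftLim p (jumpTime y j).toNNReal ᵥ* Λ)
      - Function.leftLim p (jumpTime y j).toNNReal with hD
  have key : ∀ j, jumpTime y j ≠ ∞ → (∫ s in (0 : ℝ)..(jumpTime y j).toReal, G s)
      = p (jumpTime y j).toNNReal - p 0 - ∑ k ∈ Finset.Icc 1 j, D k := by
    intro j
    induction j with
    | zero => simp [jumpTime_zero]
    | succ j ih =>
      intro hj1
      have hj := jumpTime_ne_top_of_succ hj1
      obtain ⟨φ, hφ, hpφ, hjump⟩ := hflow.2 j hj
      obtain ⟨hleft, hright⟩ := hjump hj1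
      have hcoe := ENNReal.coe_toNNReal hj1
      have h1 := integral_field_eq hy hp hφ hpφ (t := (jumpTime y (j + 1)).toNNReal)
        (by rw [hcoe]; exact jumpTime_le_succ y j) hcoe.le
      rw [ENNReal.coe_toNNReal_eq_toReal, ← hleft] at h1
      rw [← intervalIntegral.integral_add_adjacent_intervals (hint _ (jumpTime y j).toReal)
        (hint _ _), ih hj, h1, Finset.sum_Icc_succ_top (by lia), hright]
      simp only [hD]
      abel
  intro t
  obtain ⟨h1, h2⟩ := hy.jumpCount_spec t
  obtain ⟨φ, hφ, hpφ, -⟩ := hflow.2 _ (jumpTime_ne_top_of_le h1)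
  rw [finsum_jumpTime_eq h1 h2 D,
    ← intervalIntegral.integral_add_adjacent_intervals
      (hint _ (jumpTime y (jumpCount y t)).toReal) (hint _ _), key _ (jumpTime_ne_top_of_le h1),
    integral_field_eq hy hp hφ hpφ h1 h2.le, hpφ t h1 h2, ← hflow.1]
  abel

/-- Between two jump times a solution differs from the integral of the vector field by a
constant. -/
theorem SolvesFilteringEq.exists_eq_add_integral {Λ : Matrix I I ℝ} {h : I → O}
    {ν : O → I → ℝ} {μ : I → ℝ} {y : ℝ≥0 → O} {p : ℝ≥0 → I → ℝ}
    (hp : SolvesFilteringEq Λ h ν μ y p) (j : ℕ) :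
    ∃ c : I → ℝ, ∀ t : ℝ≥0, jumpTime y j ≤ t → (t : ℝ≥0∞) < jumpTime y (j + 1) →
      p t = (∫ s in (0 : ℝ)..t, field Λ h (y s.toNNReal) (p s.toNNReal)) + c := by
  refine ⟨opH h ν (y 0) μ + ∑ k ∈ Finset.Icc 1 j, (opH h ν (y (jumpTime y k).toNNReal)
    (Function.leftLim p (jumpTime y k).toNNReal ᵥ* Λ)
      - Function.leftLim p (jumpTime y k).toNNReal), fun t h1 h2 => ?_⟩
  rw [hp.2 t, finsum_jumpTime_eq h1 h2]
  abel

/-- Uniqueness between two consecutive jump times, from uniqueness for the locally Lipschitz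
differential equation. -/
theorem SolvesFilteringEq.eq_of_eq_at_jumpTime {Λ : Matrix I I ℝ} {h : I → O}
    {ν : O → I → ℝ} {μ : I → ℝ} {y : ℝ≥0 → O} (hy : IsStepPath y) {p q : ℝ≥0 → I → ℝ}
    (hp : SolvesFilteringEq Λ h ν μ y p) (hq : SolvesFilteringEq Λ h ν μ y q) {j : ℕ}
    (hpq : p (jumpTime y j).toNNReal = q (jumpTime y j).toNNReal) {t : ℝ≥0}
    (h1 : jumpTime y j ≤ t) (h2 : (t : ℝ≥0∞) < jumpTime y (j + 1)) : p t = q t := by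
  have hj := jumpTime_ne_top_of_le h1
  obtain ⟨b, hb⟩ : ∃ b, b = y (jumpTime y j).toNNReal := ⟨_, rfl⟩
  obtain ⟨a, ha⟩ : ∃ a, a = (jumpTime y j).toNNReal := ⟨_, rfl⟩
  have hat : a ≤ t := ha ▸ (jumpTime_le_coe_iff hj).1 h1
  have hmem : ∀ s : ℝ, s ∈ Set.Icc (a : ℝ) t →
      jumpTime y j ≤ s.toNNReal ∧ (s.toNNReal : ℝ≥0∞) < jumpTime y (j + 1) := by
    intro s hs
    have hs0 : 0 ≤ s := a.coe_nonneg.trans hs.1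
    constructor
    · rw [jumpTime_le_coe_iff hj, ← NNReal.coe_le_coe, Real.coe_toNNReal s hs0, ← ha]
      exact hs.1
    · refine lt_of_le_of_lt ?_ h2
      rw [ENNReal.coe_le_coe, ← NNReal.coe_le_coe, Real.coe_toNNReal s hs0]
      exact hs.2
  have key : ∀ r : ℝ≥0 → I → ℝ, SolvesFilteringEq Λ h ν μ y r →
      ContinuousOn (fun s : ℝ => r s.toNNReal) (Set.Icc (a : ℝ) t) ∧
      ∀ s ∈ Set.Ico (a : ℝ) t, HasDerivWithinAt (fun s : ℝ => r s.toNNReal)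
        (field Λ h b (r s.toNNReal)) (Set.Ici s) s := by
    intro r hr
    obtain ⟨c, hc⟩ := hr.exists_eq_add_integral j
    have hcad := IsCadlag.field hy hr.1 Λ h
    have heq : ∀ s ∈ Set.Icc (a : ℝ) t, r s.toNNReal
        = (∫ u in (0 : ℝ)..s, field Λ h (y u.toNNReal) (r u.toNNReal)) + c := by
      intro s hs
      rw [hc _ (hmem s hs).1 (hmem s hs).2, Real.coe_toNNReal s (a.coe_nonneg.trans hs.1)]
    constructor
    · refine ContinuousOn.congr (Continuous.continuousOn ?_) heq
      exact (intervalIntegral.continuous_primitive hcad.intervalIntegrable 0).add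
        continuous_const
    · intro s hs
      have hrc : ContinuousWithinAt (fun u : ℝ => field Λ h (y u.toNNReal) (r u.toNNReal))
          (Set.Ioi s) s :=
        (hcad s.toNNReal).1.comp continuous_real_toNNReal.continuousWithinAt
          fun u hu => Real.toNNReal_mono (le_of_lt hu)
      have hd := intervalIntegral.integral_hasDerivWithinAt_right (s := Set.Ici s)
        (hcad.intervalIntegrable 0 s)
        (hcad.stronglyMeasurable.stronglyMeasurableAtFilter) hrc
      have hsI : s ∈ Set.Icc (a : ℝ) t := ⟨hs.1, hs.2.le⟩
      rw [eq_of_jumpTime_le_of_lt (hmem s hsI).1 (hmem s hsI).2, ← hb] at hd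
      refine (hd.add_const c).congr_of_eventuallyEq ?_ (heq s hsI)
      filter_upwards [Icc_mem_nhdsGE hs.2] with u hu
      exact heq u ⟨hs.1.trans hu.1, hu.2⟩
  obtain ⟨R, hR⟩ : ∃ R, ∀ s : ℝ, s ∈ Set.Icc (a : ℝ) t →
      p s.toNNReal ∈ Metric.closedBall 0 R ∧ q s.toNNReal ∈ Metric.closedBall 0 R := by
    obtain ⟨R, hR⟩ := ((hp.1.isBounded_image t).union (hq.1.isBounded_image t)).exists_norm_le
    refine ⟨R, fun s hs => ?_⟩
    have hst : s.toNNReal ∈ Set.Icc 0 t :=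
      ⟨zero_le, by simpa using Real.toNNReal_mono hs.2⟩
    simp only [mem_closedBall_zero_iff]
    exact ⟨hR _ (Or.inl ⟨_, hst, rfl⟩), hR _ (Or.inr ⟨_, hst, rfl⟩)⟩
  obtain ⟨K, hK⟩ := exists_lipschitzOnWith_field Λ h b R
  have huniq := ODE_solution_unique_of_mem_Icc_right (v := fun _ => field Λ h b)
    (s := fun _ => Metric.closedBall 0 R) (fun _ _ => hK) (key p hp).1 (key p hp).2
    (fun s hs => (hR s ⟨hs.1, hs.2.le⟩).1) (key q hq).1 (key q hq).2
    (fun s hs => (hR s ⟨hs.1, hs.2.le⟩).2) (by simpa [ha] using hpq)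
  simpa using huniq ⟨NNReal.coe_le_coe.2 hat, le_rfl⟩

/-- At time `t` the right-hand side of the filtering equation only depends on the path strictly
before `t`. -/
theorem SolvesFilteringEq.eq_of_eq_before {Λ : Matrix I I ℝ} {h : I → O}
    {ν : O → I → ℝ} {μ : I → ℝ} {y : ℝ≥0 → O} (hy : IsStepPath y) {p q : ℝ≥0 → I → ℝ}
    (hp : SolvesFilteringEq Λ h ν μ y p) (hq : SolvesFilteringEq Λ h ν μ y q) {t : ℝ≥0}
    (hpq : ∀ s < t, p s = q s) : p t = q t := by
  rw [hp.2 t, hq.2 t]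
  congr 1
  · congr 1
    refine intervalIntegral.integral_congr_ae ?_
    filter_upwards [compl_mem_ae_iff.2 (measure_singleton (t : ℝ))] with s hs hst
    rw [Set.uIoc_of_le t.coe_nonneg] at hst
    rw [hpq s.toNNReal]
    rw [← NNReal.coe_lt_coe, Real.coe_toNNReal s hst.1.le]
    exact lt_of_le_of_ne hst.2 hs
  · refine finsum_congr fun k => finsum_congr fun hk => ?_
    have hkt := jumpTime_ne_top_of_le hk.2
    rw [hp.1.leftLim_congr (hy.toNNReal_jumpTime_pos hk.1 hkt) fun s hs =>
      hpq s (hs.trans_le ((jumpTime_le_coe_iff hkt).1 hk.2))]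

theorem SolvesFilteringEq.unique {Λ : Matrix I I ℝ} {h : I → O}
    {ν : O → I → ℝ} {μ : I → ℝ} {y : ℝ≥0 → O} (hy : IsStepPath y) {p q : ℝ≥0 → I → ℝ}
    (hp : SolvesFilteringEq Λ h ν μ y p) (hq : SolvesFilteringEq Λ h ν μ y q) (t : ℝ≥0) :
    p t = q t := by
  have key : ∀ j, jumpTime y j ≠ ∞ → ∀ s ≤ (jumpTime y j).toNNReal, p s = q s := by
    intro j
    induction j with
    | zero =>
      intro _ s hs
      have hs0 : s = 0 := by simpa [jumpTime_zero] using hs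
      subst hs0
      exact hp.eq_of_eq_before hy hq fun s hs => absurd hs not_lt_zero
    | succ j ih =>
      intro hj1
      have hj := jumpTime_ne_top_of_succ hj1
      have hlt : ∀ s < (jumpTime y (j + 1)).toNNReal, p s = q s := by
        intro s hs
        rcases le_total s (jumpTime y j).toNNReal with hsj | hsj
        · exact ih hj s hsj
        · exact hp.eq_of_eq_at_jumpTime hy hq (ih hj _ le_rfl) ((jumpTime_le_coe_iff hj).2 hsj)
            ((coe_lt_jumpTime_iff hj1).2 hs)
      intro s hs
      rcases hs.lt_or_eq with h1 | rfl
      · exact hlt s h1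
      · exact hp.eq_of_eq_before hy hq hlt
  obtain ⟨h1, h2⟩ := hy.jumpCount_spec t
  exact hp.eq_of_eq_at_jumpTime hy hq (key _ (jumpTime_ne_top_of_le h1) _ le_rfl) h1 h2

end Equation

/-! ### Construction of the solution -/

section Construction

variable {I O : Type*} [Fintype I] [DecidableEq I]

/-- The state of the filter at the successive jump times of the observed path `y`. Only the values at
indices with finite jump time are meaningful. -/
def filterState (Λ : Matrix I I ℝ) (h : I → O) (ν : O → I → ℝ) (μ : I → ℝ) (y : ℝ≥0 → O) :
    ℕ → I → ℝ
  | 0 => opH h ν (y 0) μ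
  | j + 1 => opH h ν (y (jumpTime y (j + 1)).toNNReal)
      (flow Λ h (y (jumpTime y j).toNNReal) (filterState Λ h ν μ y j)
        ((jumpTime y (j + 1)).toReal - (jumpTime y j).toReal) ᵥ* Λ)

/-- The filter along the observed path `y`: from the last jump time on it follows the flow started
at the state at that time. -/
def filterPath (Λ : Matrix I I ℝ) (h : I → O) (ν : O → I → ℝ) (μ : I → ℝ) (y : ℝ≥0 → O)
    (t : ℝ≥0) : I → ℝ :=
  flow Λ h (y (jumpTime y (jumpCount y t)).toNNReal) (filterState Λ h ν μ y (jumpCount y t))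
    (t - (jumpTime y (jumpCount y t)).toReal)

variable {Λ : Matrix I I ℝ} {h : I → O} {ν : O → I → ℝ} {μ : I → ℝ} {y : ℝ≥0 → O}

theorem IsStepPath.toReal_jumpTime_sub_nonneg (hy : IsStepPath y) {j : ℕ}
    (hj : jumpTime y (j + 1) ≠ ∞) :
    0 ≤ (jumpTime y (j + 1)).toReal - (jumpTime y j).toReal :=
  sub_nonneg.2 (NNReal.coe_le_coe.2 (hy.toNNReal_jumpTime_lt_succ hj).le)

theorem filterState_mem_levelSimplex (hΛ : IsRateMatrix Λ) (hν : ∀ a, ν a ∈ levelSimplex h a)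
    (hμ : ∀ i, 0 ≤ μ i) (hy : IsStepPath y) {j : ℕ} (hj : jumpTime y j ≠ ∞) :
    filterState Λ h ν μ y j ∈ levelSimplex h (y (jumpTime y j).toNNReal) := by
  induction j with
  | zero => exact opH_mem_levelSimplex hν fun i _ => hμ i
  | succ j ih =>
    have hmem := flow_mem_levelSimplex hΛ (ih (jumpTime_ne_top_of_succ hj))
      (hy.toReal_jumpTime_sub_nonneg hj)
    exact opH_mem_levelSimplex hν fun i hi => vecMul_apply_nonneg_of_ne hΛ
      (hy.apply_jumpTime_succ_ne hj).symm (levelSimplex_subset_levelCone hmem) hi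

theorem filterPath_eq (hy : IsStepPath y) {j : ℕ} {t : ℝ≥0} (h1 : jumpTime y j ≤ t)
    (h2 : (t : ℝ≥0∞) < jumpTime y (j + 1)) :
    filterPath Λ h ν μ y t = flow Λ h (y (jumpTime y j).toNNReal) (filterState Λ h ν μ y j)
      (t - (jumpTime y j).toReal) := by
  rw [filterPath, hy.jumpCount_eq h1 h2]

theorem isFlowCurve_filterState (hΛ : IsRateMatrix Λ) (hν : ∀ a, ν a ∈ levelSimplex h a)
    (hμ : ∀ i, 0 ≤ μ i) (hy : IsStepPath y) {j : ℕ} (hj : jumpTime y j ≠ ∞) :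
    IsFlowCurve Λ h (y (jumpTime y j).toNNReal) (filterState Λ h ν μ y j)
      (flow Λ h (y (jumpTime y j).toNNReal) (filterState Λ h ν μ y j)) :=
  isFlowCurve_flow hΛ (filterState_mem_levelSimplex hΛ hν hμ hy hj)

theorem filterPath_jumpTime (hΛ : IsRateMatrix Λ) (hν : ∀ a, ν a ∈ levelSimplex h a)
    (hμ : ∀ i, 0 ≤ μ i) (hy : IsStepPath y) {j : ℕ} (hj : jumpTime y j ≠ ∞) :
    filterPath Λ h ν μ y (jumpTime y j).toNNReal = filterState Λ h ν μ y j := by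
  have hcoe := ENNReal.coe_toNNReal hj
  rw [filterPath_eq hy hcoe.ge (by rw [hcoe]; exact hy.jumpTime_lt_succ hj),
    ENNReal.coe_toNNReal_eq_toReal, sub_self]
  exact (isFlowCurve_filterState hΛ hν hμ hy hj).1

/-- On `(T_j, T_{j+1}]` the left limits of the filter are given by the flow. -/
theorem tendsto_filterPath_nhdsLT (hΛ : IsRateMatrix Λ) (hν : ∀ a, ν a ∈ levelSimplex h a)
    (hμ : ∀ i, 0 ≤ μ i) (hy : IsStepPath y) {j : ℕ} {t : ℝ≥0} (h1 : jumpTime y j < t)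
    (h2 : (t : ℝ≥0∞) ≤ jumpTime y (j + 1)) :
    Tendsto (filterPath Λ h ν μ y) (𝓝[<] t)
      (𝓝 (flow Λ h (y (jumpTime y j).toNNReal) (filterState Λ h ν μ y j)
        (t - (jumpTime y j).toReal))) := by
  have hj := jumpTime_ne_top_of_le h1.le
  have hlt : (jumpTime y j).toNNReal < t := by
    rw [← ENNReal.coe_lt_coe, ENNReal.coe_toNNReal hj]; exact h1
  have hc := (isFlowCurve_filterState hΛ hν hμ hy hj).2 (t - (jumpTime y j).toReal)
    (sub_nonneg.2 (NNReal.coe_le_coe.2 hlt.le))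
  have hmem : Set.Ioo (jumpTime y j).toNNReal t ∈ 𝓝[<] t := Ioo_mem_nhdsLT hlt
  have hsub : Tendsto (fun s : ℝ≥0 => (s : ℝ) - (jumpTime y j).toReal) (𝓝[<] t)
      (𝓝[Set.Ici 0] (t - (jumpTime y j).toReal)) := by
    refine tendsto_nhdsWithin_iff.2 ⟨?_, ?_⟩
    · exact (Continuous.tendsto (by fun_prop) t).mono_left nhdsWithin_le_nhds
    · filter_upwards [hmem] with s hs
      exact sub_nonneg.2 (NNReal.coe_le_coe.2 hs.1.le)
  refine (hc.continuousWithinAt.tendsto.comp hsub).congr' ?_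
  filter_upwards [hmem] with s hs
  exact (filterPath_eq hy ((jumpTime_le_coe_iff hj).2 hs.1.le)
    ((ENNReal.coe_lt_coe.2 hs.2).trans_le h2)).symm

theorem isCadlag_filterPath (hΛ : IsRateMatrix Λ) (hν : ∀ a, ν a ∈ levelSimplex h a)
    (hμ : ∀ i, 0 ≤ μ i) (hy : IsStepPath y) : IsCadlag (filterPath Λ h ν μ y) := by
  intro t
  obtain ⟨h1, h2⟩ := hy.jumpCount_spec t
  set j := jumpCount y t
  have hj := jumpTime_ne_top_of_le h1
  constructor
  · have hc := (isFlowCurve_filterState hΛ hν hμ hy hj).2 (t - (jumpTime y j).toReal)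
      (sub_nonneg.2 (NNReal.coe_le_coe.2 ((jumpTime_le_coe_iff hj).1 h1)))
    have hsub : ContinuousWithinAt (fun s : ℝ≥0 => (s : ℝ) - (jumpTime y j).toReal)
        (Set.Ici t) t := by fun_prop
    have hcomp := ContinuousWithinAt.comp (x := t) hc.continuousWithinAt hsub fun s hs =>
      sub_nonneg.2 (NNReal.coe_le_coe.2 (((jumpTime_le_coe_iff hj).1 h1).trans hs))
    refine hcomp.congr_of_eventuallyEq ?_ (filterPath_eq hy h1 h2)
    have hev : ∀ᶠ s : ℝ≥0 in 𝓝 t, (s : ℝ≥0∞) < jumpTime y (j + 1) :=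
      ENNReal.continuous_coe.continuousAt.eventually_lt continuousAt_const h2
    filter_upwards [nhdsWithin_le_nhds hev, self_mem_nhdsWithin] with s hs hts
    exact filterPath_eq hy (h1.trans (ENNReal.coe_le_coe.2 hts)) hs
  · rcases h1.lt_or_eq with h3 | h3
    · exact ⟨_, tendsto_filterPath_nhdsLT hΛ hν hμ hy h3 h2.le⟩
    · cases hk : j with
      | zero =>
        rw [hk, jumpTime_zero] at h3
        have ht : t = 0 := by exact_mod_cast h3.symm
        exact ⟨0, by simp [ht]⟩
      | succ k =>
        rw [hk] at h3 hj
        exact ⟨_, tendsto_filterPath_nhdsLT hΛ hν hμ hy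
          (h3 ▸ hy.jumpTime_lt_succ (jumpTime_ne_top_of_succ hj)) h3.ge⟩

theorem followsFlowWithJumps_filterPath (hΛ : IsRateMatrix Λ)
    (hν : ∀ a, ν a ∈ levelSimplex h a) (hμ : ∀ i, 0 ≤ μ i) (hy : IsStepPath y) :
    FollowsFlowWithJumps Λ h ν μ y (filterPath Λ h ν μ y) := by
  refine ⟨?_, fun j hj => ⟨flow Λ h (y (jumpTime y j).toNNReal) (filterState Λ h ν μ y j),
    ?_, fun t h1 h2 => filterPath_eq hy h1 h2, fun hj1 => ?_⟩⟩
  · exact filterPath_jumpTime (j := 0) hΛ hν hμ hy (by simp [jumpTime_zero])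
  · rw [filterPath_jumpTime hΛ hν hμ hy hj]
    exact isFlowCurve_filterState hΛ hν hμ hy hj
  · have hcoe := ENNReal.coe_toNNReal hj1
    have hlim := tendsto_filterPath_nhdsLT hΛ hν hμ hy (t := (jumpTime y (j + 1)).toNNReal)
      (by rw [hcoe]; exact hy.jumpTime_lt_succ hj) hcoe.le
    have : (𝓝[<] (jumpTime y (j + 1)).toNNReal).NeBot :=
      nhdsLT_neBot_of_exists_lt ⟨_, hy.toNNReal_jumpTime_lt_succ hj1⟩
    have hleft := leftLim_eq_of_tendsto hlim
    rw [ENNReal.coe_toNNReal_eq_toReal] at hleft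
    refine ⟨hleft, ?_⟩
    rw [hleft, filterPath_jumpTime hΛ hν hμ hy hj1]
    rfl

end Construction

/-! ### The unnormalized filter -/

section Unnormalized

variable {I O : Type*} [Fintype I] [DecidableEq I]

/-- The unnormalized filter at the jump times of `y`: it satisfies the linear analogue of the
recursion of `filterState`, without normalization. -/
def unnormState (Λ : Matrix I I ℝ) (h : I → O) (μ : I → ℝ) (y : ℝ≥0 → O) : ℕ → I → ℝ
  | 0 => levelInd h (y 0) * μ
  | j + 1 => levelInd h (y (jumpTime y (j + 1)).toNNReal) *
      ((unnormState Λ h μ y j ᵥ* NormedSpace.exp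
        (((jumpTime y (j + 1)).toReal - (jumpTime y j).toReal) •
          levelMatrix Λ h (y (jumpTime y j).toNNReal))) ᵥ* Λ)

/-- The unnormalized filter along the observed path `y`: the linear flow between jump times. -/
def unnormPath (Λ : Matrix I I ℝ) (h : I → O) (μ : I → ℝ) (y : ℝ≥0 → O) (t : ℝ≥0) : I → ℝ :=
  unnormState Λ h μ y (jumpCount y t) ᵥ* NormedSpace.exp
    ((t - (jumpTime y (jumpCount y t)).toReal) •
      levelMatrix Λ h (y (jumpTime y (jumpCount y t)).toNNReal))

variable {Λ : Matrix I I ℝ} {h : I → O} {ν : O → I → ℝ} {μ : I → ℝ} {y : ℝ≥0 → O}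

theorem unnormState_mem_levelCone (hΛ : IsRateMatrix Λ) (hμ : ∀ i, 0 ≤ μ i) (hy : IsStepPath y)
    {j : ℕ} (hj : jumpTime y j ≠ ∞) :
    unnormState Λ h μ y j ∈ levelCone h (y (jumpTime y j).toNNReal) := by
  induction j with
  | zero => exact levelInd_mul_mem_levelCone fun i _ => hμ i
  | succ j ih =>
    exact levelInd_mul_mem_levelCone fun i hi => vecMul_apply_nonneg_of_ne hΛ
      (hy.apply_jumpTime_succ_ne hj).symm (vecMul_exp_mem_levelCone hΛ
        (ih (jumpTime_ne_top_of_succ hj)) (hy.toReal_jumpTime_sub_nonneg hj)) hi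

theorem unnormPath_eq (hy : IsStepPath y) {j : ℕ} {t : ℝ≥0} (h1 : jumpTime y j ≤ t)
    (h2 : (t : ℝ≥0∞) < jumpTime y (j + 1)) :
    unnormPath Λ h μ y t = unnormState Λ h μ y j ᵥ* NormedSpace.exp
      ((t - (jumpTime y j).toReal) • levelMatrix Λ h (y (jumpTime y j).toNNReal)) := by
  rw [unnormPath, hy.jumpCount_eq h1 h2]

theorem unnormPath_jumpTime (hy : IsStepPath y) {j : ℕ} (hj : jumpTime y j ≠ ∞) :
    unnormPath Λ h μ y (jumpTime y j).toNNReal = unnormState Λ h μ y j := by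
  have hcoe := ENNReal.coe_toNNReal hj
  rw [unnormPath_eq hy hcoe.ge (by rw [hcoe]; exact hy.jumpTime_lt_succ hj),
    ENNReal.coe_toNNReal_eq_toReal, sub_self]
  simp

theorem unnormPath_mem_levelCone (hΛ : IsRateMatrix Λ) (hμ : ∀ i, 0 ≤ μ i) (hy : IsStepPath y)
    (t : ℝ≥0) : unnormPath Λ h μ y t ∈ levelCone h (y t) := by
  obtain ⟨h1, h2⟩ := hy.jumpCount_spec t
  have hj := jumpTime_ne_top_of_le h1
  rw [eq_of_jumpTime_le_of_lt h1 h2, unnormPath]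
  exact vecMul_exp_mem_levelCone hΛ (unnormState_mem_levelCone hΛ hμ hy hj)
    (sub_nonneg.2 (NNReal.coe_le_coe.2 ((jumpTime_le_coe_iff hj).1 h1)))

/-- Semigroup property of the unnormalized filter between jump times. -/
theorem unnormPath_eq_vecMul_exp (hy : IsStepPath y) {j : ℕ} {r s : ℝ≥0}
    (h1 : jumpTime y j ≤ r) (hrs : r ≤ s) (h2 : (s : ℝ≥0∞) < jumpTime y (j + 1)) :
    unnormPath Λ h μ y s = unnormPath Λ h μ y r ᵥ* NormedSpace.exp
      (((s : ℝ) - r) • levelMatrix Λ h (y r)) := by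
  have hrs' : (r : ℝ≥0∞) ≤ s := ENNReal.coe_le_coe.2 hrs
  rw [unnormPath_eq hy (h1.trans hrs') h2, unnormPath_eq hy h1 (hrs'.trans_lt h2),
    Matrix.vecMul_vecMul, eq_of_jumpTime_le_of_lt h1 (hrs'.trans_lt h2), ← exp_add_smul]
  congr 3
  ring

/-- Update of the unnormalized filter at a jump time, seen from an earlier time. -/
theorem unnormState_succ_eq (hy : IsStepPath y) {j : ℕ} {r : ℝ≥0} (h1 : jumpTime y j ≤ r)
    (h2 : (r : ℝ≥0∞) < jumpTime y (j + 1)) :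
    unnormState Λ h μ y (j + 1) = levelInd h (y (jumpTime y (j + 1)).toNNReal) *
      ((unnormPath Λ h μ y r ᵥ* NormedSpace.exp
        (((jumpTime y (j + 1)).toReal - r) • levelMatrix Λ h (y r))) ᵥ* Λ) := by
  rw [unnormPath_eq hy h1 h2, Matrix.vecMul_vecMul (unnormState Λ h μ y j),
    eq_of_jumpTime_le_of_lt h1 h2, ← exp_add_smul, unnormState]
  congr 5
  ring

theorem flow_smul {c : ℝ} (hc : c ≠ 0) (a : O) (x : I → ℝ) (s : ℝ) :
    flow Λ h a (c • x) s = flow Λ h a x s := by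
  rw [flow, Matrix.smul_vecMul, normalize_smul hc, flow]

/-- As long as the unnormalized filter does not vanish, the filter is its normalization. -/
theorem filterState_eq_normalize {j : ℕ}
    (hpos : ∀ k ≤ j, 0 < ∑ i, unnormState Λ h μ y k i)
    (hpos' : ∀ k < j, 0 < ∑ i, (unnormState Λ h μ y k ᵥ* NormedSpace.exp
      (((jumpTime y (k + 1)).toReal - (jumpTime y k).toReal) •
          levelMatrix Λ h (y (jumpTime y k).toNNReal))) i) :
    filterState Λ h ν μ y j = normalize (unnormState Λ h μ y j) := by
  induction j with
  | zero => exact opH_eq_normalize (hpos 0 le_rfl).ne'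
  | succ j ih =>
    have ih' := ih (fun k hk => hpos k (by lia)) (fun k hk => hpos' k (by lia))
    have hc := inv_ne_zero (hpos j (by lia)).ne'
    have hc' := inv_ne_zero (hpos' j (by lia)).ne'
    have hpos1 := hpos (j + 1) le_rfl
    rw [unnormState] at hpos1
    rw [filterState, ih', normalize, flow_smul hc, flow, normalize, Matrix.smul_vecMul,
      opH_eq_normalize]
    · rw [mul_smul_comm, normalize_smul hc', unnormState]
    · rw [mul_smul_comm]
      simp only [Pi.smul_apply, smul_eq_mul, ← Finset.mul_sum]
      exact mul_ne_zero hc' hpos1.ne'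

theorem filterPath_eq_normalize (hΛ : IsRateMatrix Λ) (hμ : ∀ i, 0 ≤ μ i) (hy : IsStepPath y)
    {t : ℝ≥0} (hpos : ∀ s ≤ t, 0 < ∑ i, unnormPath Λ h μ y s i) :
    filterPath Λ h ν μ y t = normalize (unnormPath Λ h μ y t) := by
  obtain ⟨h1, h2⟩ := hy.jumpCount_spec t
  have hfin : ∀ k ≤ jumpCount y t, jumpTime y k ≠ ∞ := fun k hk =>
    jumpTime_ne_top_of_le ((monotone_jumpTime y hk).trans h1)
  have hpos1 : ∀ k ≤ jumpCount y t, 0 < ∑ i, unnormState Λ h μ y k i := by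
    intro k hk
    rw [← unnormPath_jumpTime hy (hfin k hk)]
    exact hpos _ ((jumpTime_le_coe_iff (hfin k hk)).1 ((monotone_jumpTime y hk).trans h1))
  rw [filterPath, filterState_eq_normalize hpos1, normalize,
    flow_smul (inv_ne_zero (hpos1 _ le_rfl).ne'), flow, unnormPath]
  intro k hk
  exact sum_vecMul_exp_pos hΛ (unnormState_mem_levelCone hΛ hμ hy (hfin k hk.le))
    (hpos1 k hk.le) (hy.toReal_jumpTime_sub_nonneg (hfin (k + 1) hk))

/-- Induction along `[0, ∞)`. -/
theorem nnreal_induction {p : ℝ≥0 → Prop} (h0 : p 0) (hright : ∀ s, p s → ∃ u > s, ∀ r, s < r →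
    r < u → p r) (hleft : ∀ s, 0 < s → (∀ r < s, p r) → p s) (t : ℝ≥0) : p t := by
  by_contra hcon
  have hne : {s | ¬ p s}.Nonempty := ⟨t, hcon⟩
  have hlt : ∀ r < sInf {s | ¬ p s}, p r := fun r hr => not_not.1 (notMem_of_lt_csInf hr
    (OrderBot.bddBelow _))
  have hm : p (sInf {s | ¬ p s}) := by
    rcases eq_zero_or_pos (sInf {s | ¬ p s}) with h | h
    · rwa [h]
    · exact hleft _ h hlt
  obtain ⟨u, hu, hpu⟩ := hright _ hm
  obtain ⟨r, hr, hru⟩ := exists_lt_of_csInf_lt hne hu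
  refine hr ?_
  rcases (csInf_le (OrderBot.bddBelow _) hr).lt_or_eq with h | h
  · exact hpu r h hru
  · rwa [← h]

/-- If the signal path `x` starts in the support of `μ` and every jump of it has positive rate,
then the unnormalized filter charges the current state of the signal. -/
theorem unnormPath_apply_pos (hΛ : IsRateMatrix Λ) (hμ : ∀ i, 0 ≤ μ i) {x : ℝ≥0 → I}
    (hx : IsStepPath x) (hyx : ∀ s, y s = h (x s)) {t : ℝ≥0} (h0 : 0 < μ (x 0))
    (hjump : ∀ s, 0 < s → s ≤ t → ∀ i, (∀ᶠ r in 𝓝[<] s, x r = i) → i ≠ x s → 0 < Λ i (x s))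
    {s : ℝ≥0} (hst : s ≤ t) : 0 < unnormPath Λ h μ y s (x s) := by
  have hy : IsStepPath y := by
    have := hx.comp h
    rwa [← funext hyx] at this
  revert hst
  refine nnreal_induction (p := fun s => s ≤ t → 0 < unnormPath Λ h μ y s (x s)) ?_ ?_ ?_ s
  · intro _
    have h00 : (jumpTime y 0).toNNReal = 0 := by simp [jumpTime_zero]
    rw [← h00, unnormPath_jumpTime hy (by simp [jumpTime_zero]), h00, unnormState, Pi.mul_apply,
      levelInd_apply_of_eq (hyx 0).symm, one_mul]
    exact h0
  · intro s hs
    obtain ⟨u, hu, hxu⟩ := hx.exists_gap s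
    obtain ⟨h1, h2⟩ := hy.jumpCount_spec s
    obtain ⟨w, hw, hwj⟩ := ENNReal.lt_iff_exists_nnreal_btwn.1 h2
    refine ⟨min u w, lt_min hu (by exact_mod_cast hw), fun r hsr hru hrt => ?_⟩
    rw [hxu r hsr.le (hru.trans_le (min_le_left _ _)), unnormPath_eq_vecMul_exp hy h1 hsr.le
      ((ENNReal.coe_lt_coe.2 (hru.trans_le (min_le_right _ _))).trans hwj)]
    exact vecMul_exp_apply_pos_self hΛ (unnormPath_mem_levelCone hΛ hμ hy s)
      (sub_nonneg.2 (NNReal.coe_le_coe.2 hsr.le)) (hs (hsr.le.trans hrt))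
  · intro s hs0 ih hst
    obtain ⟨i, u, hus, hxu⟩ := hx.exists_gap_left hs0
    have hev : ∀ᶠ r in 𝓝[<] s, x r = i := by
      filter_upwards [Ioo_mem_nhdsLT hus] with r hr using hxu r hr.1 hr.2
    obtain ⟨h1, h2⟩ := hy.jumpCount_spec s
    -- the value at `s` is computed from the value at a time `r < s` after the previous jump time
    rcases h1.lt_or_eq with hlt | heq
    · obtain ⟨w, hw, hws⟩ := ENNReal.lt_iff_exists_nnreal_btwn.1 hlt
      have hws' : w < s := by exact_mod_cast hws
      obtain ⟨r, hr, hrs⟩ := exists_between (max_lt hus hws')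
      have hxr : x r = i := hxu r ((le_max_left _ _).trans_lt hr) hrs
      have hjr : jumpTime y (jumpCount y s) ≤ r := hw.le.trans
        (ENNReal.coe_le_coe.2 ((le_max_right _ _).trans hr.le))
      have hpos := ih r hrs (hrs.le.trans hst)
      rw [hxr] at hpos
      have hcone := unnormPath_mem_levelCone (h := h) hΛ hμ hy r
      have hrs' : (0 : ℝ) < s - r := sub_pos.2 (NNReal.coe_lt_coe.2 hrs)
      rw [unnormPath_eq_vecMul_exp hy hjr hrs.le h2]
      by_cases hi : i = x s
      · rw [← hi]
        exact vecMul_exp_apply_pos_self hΛ hcone hrs'.le hpos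
      · refine vecMul_exp_apply_pos hΛ hcone hrs' hpos (by rw [hyx r, hxr]) ?_ hi
          (hjump s hs0 hst i hev hi)
        rw [← hyx s, eq_of_jumpTime_le_of_lt h1 h2,
          eq_of_jumpTime_le_of_lt hjr ((ENNReal.coe_lt_coe.2 hrs).trans h2)]
    · have hjne := jumpTime_ne_top_of_le h1
      obtain ⟨k, hk⟩ : ∃ k, jumpCount y s = k + 1 := by
        refine Nat.exists_eq_succ_of_ne_zero fun hz => ?_
        rw [hz, jumpTime_zero] at heq
        exact hs0.ne (by exact_mod_cast heq)
      rw [hk] at heq hjne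
      have hs : (jumpTime y (k + 1)).toNNReal = s := by rw [heq, ENNReal.toNNReal_coe]
      have hlt := heq ▸ hy.jumpTime_lt_succ (jumpTime_ne_top_of_succ hjne)
      obtain ⟨w, hw, hws⟩ := ENNReal.lt_iff_exists_nnreal_btwn.1 hlt
      have hws' : w < s := by exact_mod_cast hws
      obtain ⟨r, hr, hrs⟩ := exists_between (max_lt hus hws')
      have hxr : x r = i := hxu r ((le_max_left _ _).trans_lt hr) hrs
      have hjr : jumpTime y k ≤ r := hw.le.trans
        (ENNReal.coe_le_coe.2 ((le_max_right _ _).trans hr.le))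
      have hrj : (r : ℝ≥0∞) < jumpTime y (k + 1) := by rw [heq]; exact ENNReal.coe_lt_coe.2 hrs
      have hpos := ih r hrs (hrs.le.trans hst)
      rw [hxr] at hpos
      have hcone := unnormPath_mem_levelCone (h := h) hΛ hμ hy r
      have hrs' : (0 : ℝ) ≤ (jumpTime y (k + 1)).toReal - r := by
        rw [heq]
        exact sub_nonneg.2 (NNReal.coe_le_coe.2 hrs.le)
      have hne : y r ≠ y s := by
        rw [eq_of_jumpTime_le_of_lt hjr hrj, ← hs]
        exact (hy.apply_jumpTime_succ_ne hjne).symm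
      have hi : i ≠ x s := fun hi => hne (by rw [hyx, hyx, hxr, hi])
      have hval : unnormPath Λ h μ y s = unnormState Λ h μ y (k + 1) := by
        rw [← unnormPath_jumpTime hy hjne, hs]
      have hpos' := vecMul_exp_apply_pos_self hΛ hcone hrs' hpos
      have hcone' := vecMul_exp_mem_levelCone hΛ hcone hrs'
      rw [hval, unnormState_succ_eq hy hjr hrj, hs, Pi.mul_apply,
        levelInd_apply_of_eq (hyx s).symm, one_mul]
      refine Finset.sum_pos' (fun l _ => ?_) ⟨i, Finset.mem_univ i,
        mul_pos hpos' (hjump s hs0 hst i hev hi)⟩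
      by_cases hl : h l = y r
      · refine mul_nonneg (hcone'.1 l) (hΛ.1 l (x s) ?_)
        rintro rfl
        exact hne (hl.symm.trans (hyx s).symm)
      · rw [hcone'.2 l hl, zero_mul]

end Unnormalized

/-! ### The filter of the signal observed on a time grid -/

section Grid

variable {I O : Type*} [Fintype I]

theorem continuousAt_normalize {x : I → ℝ} (hx : ∑ i, x i ≠ 0) :
    ContinuousAt (normalize : (I → ℝ) → I → ℝ) x := by
  unfold normalize
  exact ContinuousAt.smul (ContinuousAt.inv₀ (by fun_prop) hx) continuousAt_id

variable [DecidableEq I]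

/-- The unnormalized filter for the signal observed at the times `0, δ, 2δ, …` with observed
values `a 0, a 1, …`: the vector `μ D₀ Q D₁ Q ⋯ Q Dₖ`, where `Q = e^{δΛ}` and `Dₗ` is the
projection to the level set of `a l`. -/
def gridWeight (Λ : Matrix I I ℝ) (h : I → O) (μ : I → ℝ) (δ : ℝ) (a : ℕ → O) : ℕ → I → ℝ
  | 0 => levelInd h (a 0) * μ
  | k + 1 => levelInd h (a (k + 1)) *
      (gridWeight Λ h μ δ a k ᵥ* NormedSpace.exp (δ • Λ))

/-- One step of the grid filter without jump, as a perturbation of the identity. -/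
def stayMatrix (Λ : Matrix I I ℝ) (h : I → O) (b : O) (s : ℝ) : Matrix I I ℝ :=
  1 + Matrix.diagonal (levelInd h b) * (NormedSpace.exp (s • Λ) - 1) *
    Matrix.diagonal (levelInd h b)

variable {Λ : Matrix I I ℝ} {h : I → O} {μ : I → ℝ}

theorem gridWeight_support (δ : ℝ) (a : ℕ → O) (k : ℕ) (i : I) (hi : h i ≠ a k) :
    gridWeight Λ h μ δ a k i = 0 := by
  cases k <;> simp [gridWeight, levelInd_apply_of_ne hi]

theorem vecMul_stayMatrix {b : O} {w : I → ℝ} (hw : ∀ i, h i ≠ b → w i = 0) (δ : ℝ) :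
    w ᵥ* stayMatrix Λ h b δ = levelInd h b * (w ᵥ* NormedSpace.exp (δ • Λ)) := by
  rw [stayMatrix, Matrix.vecMul_add, Matrix.vecMul_one, ← Matrix.vecMul_vecMul,
    ← Matrix.vecMul_vecMul, vecMul_diagonal_levelInd, vecMul_diagonal_levelInd,
    levelInd_mul_of_support hw, Matrix.vecMul_sub, Matrix.vecMul_one, mul_sub,
    levelInd_mul_of_support hw]
  abel

theorem gridWeight_add {δ : ℝ} {a : ℕ → O} {b : O} {k m : ℕ}
    (hab : ∀ l ≤ m, a (k + l) = b) :
    gridWeight Λ h μ δ a (k + m) = gridWeight Λ h μ δ a k ᵥ* stayMatrix Λ h b δ ^ m := by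
  induction m with
  | zero => simp
  | succ m ih =>
    have hm := hab m (by lia)
    have hm1 := hab (m + 1) le_rfl
    rw [pow_succ, ← Matrix.vecMul_vecMul, ← ih fun l hl => hab l (by lia),
      vecMul_stayMatrix fun i hi => gridWeight_support δ a (k + m) i (by rwa [hm])]
    rw [← add_assoc] at hm1 ⊢
    rw [gridWeight, hm1]

section Derivatives

attribute [local instance] Matrix.linftyOpNormedRing Matrix.linftyOpNormedAlgebra

theorem hasDerivAt_mul_exp_sub_one_mul (A B : Matrix I I ℝ) :
    HasDerivAt (fun s : ℝ => A * (NormedSpace.exp (s • Λ) - 1) * B) (A * Λ * B) 0 := by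
  have h1 := hasDerivAt_exp_smul Λ 0
  rw [zero_smul, NormedSpace.exp_zero, one_mul] at h1
  exact ((h1.sub_const 1).const_mul A).mul_const B

theorem tendsto_stayMatrix_pow (b : O) {δ : ℕ → ℝ} {m : ℕ → ℕ} {τ : ℝ} (hδ : ∀ n, 0 ≤ δ n)
    (hδ0 : Tendsto δ atTop (𝓝 0)) (hm : Tendsto (fun n => m n * δ n) atTop (𝓝 τ)) :
    Tendsto (fun n => stayMatrix Λ h b (δ n) ^ m n) atTop
      (𝓝 (NormedSpace.exp (τ • levelMatrix Λ h b))) := by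
  refine tendsto_pow_exp ?_ ?_ hδ hδ0 hm
  · simp [stayMatrix]
  · exact (hasDerivAt_mul_exp_sub_one_mul _ _).const_add 1

/-- To first order, the transition probabilities between different level sets in a short time are
the rates times the length of the time interval. -/
theorem tendsto_inv_smul_exp {b c : O} (hbc : b ≠ c) {δ : ℕ → ℝ} (hδ : ∀ n, 0 < δ n)
    (hδ0 : Tendsto δ atTop (𝓝 0)) :
    Tendsto (fun n => (δ n)⁻¹ • (Matrix.diagonal (levelInd h b) * NormedSpace.exp (δ n • Λ) *
      Matrix.diagonal (levelInd h c))) atTop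
      (𝓝 (Matrix.diagonal (levelInd h b) * Λ * Matrix.diagonal (levelInd h c))) := by
  have h1 := (hasDerivAt_mul_exp_sub_one_mul (Λ := Λ) (Matrix.diagonal (levelInd h b))
    (Matrix.diagonal (levelInd h c))).tendsto_slope_zero
  have h2 : Matrix.diagonal (levelInd h b) * Matrix.diagonal (levelInd h c) = 0 := by
    rw [Matrix.diagonal_mul_diagonal, ← Matrix.diagonal_zero]
    congr 1
    ext i
    by_cases hi : h i = b
    · rw [levelInd_apply_of_ne (a := c) (fun hc => hbc (hi.symm.trans hc)), mul_zero]
    · rw [levelInd_apply_of_ne hi, zero_mul]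
  have h3 : Tendsto δ atTop (𝓝[≠] 0) :=
    tendsto_nhdsWithin_iff.2 ⟨hδ0, Eventually.of_forall fun n => (hδ n).ne'⟩
  refine (h1.comp h3).congr fun n => ?_
  simp [mul_sub, sub_mul, h2]

/-- Off the diagonal, `e^{δΛ}` is `δΛ` to first order; in particular, a transition of rate zero has
probability `o(δ)` in a time `δ`. -/
theorem tendsto_inv_mul_exp_apply {i j : I} (hij : i ≠ j) {δ : ℕ → ℝ} (hδ : ∀ n, 0 < δ n)
    (hδ0 : Tendsto δ atTop (𝓝 0)) :
    Tendsto (fun n => (δ n)⁻¹ * NormedSpace.exp (δ n • Λ) i j) atTop (𝓝 (Λ i j)) := by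
  have h1 := (hasDerivAt_mul_exp_sub_one_mul (Λ := Λ) 1 1).tendsto_slope_zero
  have h3 : Tendsto δ atTop (𝓝[≠] 0) :=
    tendsto_nhdsWithin_iff.2 ⟨hδ0, Eventually.of_forall fun n => (hδ n).ne'⟩
  have h4 := h1.comp h3
  have h5 : Tendsto _ atTop _ := ((continuous_apply_apply i j).tendsto _).comp h4
  rw [show (1 : Matrix I I ℝ) * Λ * 1 = Λ by simp] at h5
  refine h5.congr fun n => ?_
  change (δ n)⁻¹ * ((1 * (NormedSpace.exp ((0 + δ n) • Λ) - 1) * 1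
    - 1 * (NormedSpace.exp ((0 : ℝ) • Λ) - 1) * 1 : Matrix I I ℝ) i j) = _
  simp [hij]

end Derivatives

variable {y : ℝ≥0 → O}

/-- The index of the first grid point at or after the `j`-th jump time. -/
def gridIndex (y : ℝ≥0 → O) (δ : ℝ≥0) (j : ℕ) : ℕ := ⌈(jumpTime y j).toNNReal / δ⌉₊

theorem le_gridIndex_mul {δ : ℝ≥0} (hδ : 0 < δ) (j : ℕ) :
    (jumpTime y j).toNNReal ≤ gridIndex y δ j * δ :=
  (div_le_iff₀ hδ).1 (Nat.le_ceil _)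

theorem gridIndex_mul_lt {δ : ℝ≥0} (hδ : 0 < δ) (j : ℕ) :
    gridIndex y δ j * δ < (jumpTime y j).toNNReal + δ := by
  have h1 := Nat.ceil_lt_add_one (a := (jumpTime y j).toNNReal / δ) zero_le
  calc gridIndex y δ j * δ < ((jumpTime y j).toNNReal / δ + 1) * δ :=
        mul_lt_mul_of_pos_right h1 hδ
    _ = (jumpTime y j).toNNReal + δ := by
        rw [add_mul, div_mul_cancel₀ _ hδ.ne', one_mul]

theorem tendsto_gridIndex_mul {δ : ℕ → ℝ≥0} (hδ : ∀ n, 0 < δ n)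
    (hδ0 : Tendsto δ atTop (𝓝 0)) (j : ℕ) :
    Tendsto (fun n => gridIndex y (δ n) j * δ n) atTop (𝓝 (jumpTime y j).toNNReal) := by
  have h1 : Tendsto (fun n => (jumpTime y j).toNNReal + δ n) atTop
      (𝓝 ((jumpTime y j).toNNReal + 0)) := tendsto_const_nhds.add hδ0
  rw [add_zero] at h1
  exact tendsto_of_tendsto_of_tendsto_of_le_of_le tendsto_const_nhds h1
    (fun n => le_gridIndex_mul (hδ n) j) fun n => (gridIndex_mul_lt (hδ n) j).le

/-- Between two jump times the grid filter follows the linear flow in the limit. -/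
theorem tendsto_gridWeight_of_gridIndex {δ : ℕ → ℝ≥0} (hδ : ∀ n, 0 < δ n)
    (hδ0 : Tendsto δ atTop (𝓝 0)) {j : ℕ} (hj : jumpTime y j ≠ ∞) {u : I → ℝ} {c : ℕ → ℝ}
    (hlim : Tendsto (fun n => c n • gridWeight Λ h μ (δ n) (fun k => y (k * δ n))
      (gridIndex y (δ n) j)) atTop (𝓝 u)) {m : ℕ → ℕ} {s : ℝ≥0}
    (hm : ∀ᶠ n in atTop, gridIndex y (δ n) j ≤ m n)
    (hmj : ∀ᶠ n in atTop, ((m n * δ n : ℝ≥0) : ℝ≥0∞) < jumpTime y (j + 1))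
    (hms : Tendsto (fun n => m n * δ n) atTop (𝓝 s)) :
    Tendsto (fun n => c n • gridWeight Λ h μ (δ n) (fun k => y (k * δ n)) (m n)) atTop
      (𝓝 (u ᵥ* NormedSpace.exp ((s - (jumpTime y j).toReal) •
        levelMatrix Λ h (y (jumpTime y j).toNNReal)))) := by
  set b := y (jumpTime y j).toNNReal
  have hpow : Tendsto (fun n => stayMatrix Λ h b (δ n) ^ (m n - gridIndex y (δ n) j)) atTop
      (𝓝 (NormedSpace.exp ((s - (jumpTime y j).toReal) • levelMatrix Λ h b))) := by
    refine tendsto_stayMatrix_pow b (fun n => (δ n).coe_nonneg) (NNReal.tendsto_coe.2 hδ0) ?_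
    refine ((NNReal.tendsto_coe.2 hms).sub
      (NNReal.tendsto_coe.2 (tendsto_gridIndex_mul hδ hδ0 j))).congr' ?_
    filter_upwards [hm] with n hn
    push_cast [Nat.cast_sub hn]
    ring
  have hcont : Continuous fun q : (I → ℝ) × Matrix I I ℝ => q.1 ᵥ* q.2 :=
    continuous_fst.matrix_vecMul continuous_snd
  refine ((hcont.tendsto (u, _)).comp (hlim.prodMk_nhds hpow)).congr' ?_
  filter_upwards [hm, hmj] with n hn hnj
  simp only [Function.comp_apply]
  rw [Matrix.smul_vecMul, ← gridWeight_add, Nat.add_sub_cancel' hn]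
  intro l hl
  have hle : ((gridIndex y (δ n) j + l : ℕ) : ℝ≥0) ≤ m n := by
    rw [Nat.cast_le]; lia
  refine eq_of_jumpTime_le_of_lt ?_ (lt_of_le_of_lt (ENNReal.coe_le_coe.2 ?_) hnj)
  · rw [jumpTime_le_coe_iff hj]
    refine (le_gridIndex_mul (hδ n) j).trans ?_
    gcongr
    lia
  · gcongr

/-- Each jump of the observation contributes a factor `δ` to the grid filter; after division by
these factors the grid filter converges to the unnormalized filter. -/
theorem tendsto_gridWeight_gridIndex (hy : IsStepPath y) {δ : ℕ → ℝ≥0} (hδ : ∀ n, 0 < δ n)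
    (hδ0 : Tendsto δ atTop (𝓝 0)) {j : ℕ} (hj : jumpTime y j ≠ ∞) :
    Tendsto (fun n => ((δ n : ℝ)⁻¹ ^ j) • gridWeight Λ h μ (δ n) (fun k => y (k * δ n))
      (gridIndex y (δ n) j)) atTop (𝓝 (unnormState Λ h μ y j)) := by
  induction j with
  | zero =>
    have h0 : ∀ n, gridIndex y (δ n) 0 = 0 := fun n => by simp [gridIndex, jumpTime_zero]
    simp [h0, gridWeight, unnormState]
  | succ j ih =>
    have hj0 := jumpTime_ne_top_of_succ hj
    have hpos : ∀ n, 1 ≤ gridIndex y (δ n) (j + 1) := fun n =>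
      Nat.ceil_pos.2 (div_pos (hy.toNNReal_jumpTime_pos (by lia) hj) (hδ n))
    -- the last grid point before the jump
    set m : ℕ → ℕ := fun n => gridIndex y (δ n) (j + 1) - 1
    have hm1 : ∀ n, gridIndex y (δ n) (j + 1) = m n + 1 := fun n =>
      (Nat.sub_add_cancel (hpos n)).symm
    have hmlt : ∀ n, m n * δ n < (jumpTime y (j + 1)).toNNReal := by
      intro n
      have := gridIndex_mul_lt (y := y) (hδ n) (j + 1)
      rw [hm1 n] at this
      push_cast at this
      rw [add_mul, one_mul] at this
      exact lt_of_add_lt_add_right this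
    have hms : Tendsto (fun n => m n * δ n) atTop (𝓝 (jumpTime y (j + 1)).toNNReal) := by
      have h1 := (tendsto_gridIndex_mul (y := y) hδ hδ0 (j + 1)).sub hδ0
      rw [tsub_zero] at h1
      refine h1.congr fun n => ?_
      rw [hm1 n]
      push_cast
      rw [add_mul, one_mul, add_tsub_cancel_right]
    have hmj : ∀ᶠ n in atTop, ((m n * δ n : ℝ≥0) : ℝ≥0∞) < jumpTime y (j + 1) :=
      Eventually.of_forall fun n => (coe_lt_jumpTime_iff hj).2 (hmlt n)
    have hm : ∀ᶠ n in atTop, gridIndex y (δ n) j ≤ m n := by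
      filter_upwards [(tendsto_gridIndex_mul (y := y) hδ hδ0 j).eventually_lt hms
        (hy.toNNReal_jumpTime_lt_succ hj)] with n hn
      exact_mod_cast (lt_of_mul_lt_mul_right hn zero_le).le
    have hbefore := tendsto_gridWeight_of_gridIndex hδ hδ0 hj0 (ih hj0) hm hmj hms
    have hstep := tendsto_inv_smul_exp (Λ := Λ) (h := h) (hy.apply_jumpTime_succ_ne hj).symm
      (fun n => NNReal.coe_pos.2 (hδ n)) (NNReal.tendsto_coe.2 hδ0)
    have hcont : Continuous fun q : (I → ℝ) × Matrix I I ℝ => q.1 ᵥ* q.2 :=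
      continuous_fst.matrix_vecMul continuous_snd
    have hlim := (hcont.tendsto _).comp (hbefore.prodMk_nhds hstep)
    have hafter : ∀ᶠ n in atTop, ((gridIndex y (δ n) (j + 1) * δ n : ℝ≥0) : ℝ≥0∞)
        < jumpTime y (j + 1 + 1) :=
      (ENNReal.tendsto_coe.2 (tendsto_gridIndex_mul (y := y) hδ hδ0 (j + 1))).eventually_lt
        tendsto_const_nhds (by rw [ENNReal.coe_toNNReal hj]; exact hy.jumpTime_lt_succ hj)
    have hval : unnormState Λ h μ y (j + 1)
        = (unnormState Λ h μ y j ᵥ* NormedSpace.exp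
          ((((jumpTime y (j + 1)).toNNReal : ℝ) - (jumpTime y j).toReal) •
            levelMatrix Λ h (y (jumpTime y j).toNNReal))) ᵥ*
          (Matrix.diagonal (levelInd h (y (jumpTime y j).toNNReal)) * Λ *
            Matrix.diagonal (levelInd h (y (jumpTime y (j + 1)).toNNReal))) := by
      have hsupp : ∀ i, h i ≠ y (jumpTime y j).toNNReal → unnormState Λ h μ y j i = 0 := by
        intro i hi
        cases j with
        | zero =>
          have h00 : (jumpTime y 0).toNNReal = 0 := by simp [jumpTime_zero]
          rw [h00] at hi
          simp [unnormState, levelInd_apply_of_ne hi]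
        | succ j => simp [unnormState, levelInd_apply_of_ne hi]
      rw [← Matrix.vecMul_vecMul, ← Matrix.vecMul_vecMul, vecMul_diagonal_levelInd,
        vecMul_diagonal_levelInd,
        levelInd_mul_of_support (vecMul_exp_levelMatrix_support hsupp _), unnormState,
        ENNReal.coe_toNNReal_eq_toReal]
    rw [hval]
    refine hlim.congr' ?_
    filter_upwards [hm, hafter] with n hn hna
    have hyb : y (m n * δ n) = y (jumpTime y j).toNNReal := by
      refine eq_of_jumpTime_le_of_lt ?_ ((coe_lt_jumpTime_iff hj).2 (hmlt n))
      rw [jumpTime_le_coe_iff hj0]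
      refine (le_gridIndex_mul (hδ n) j).trans ?_
      gcongr
    have hyc : y (((m n + 1 : ℕ) : ℝ≥0) * δ n) = y (jumpTime y (j + 1)).toNNReal := by
      rw [← hm1 n]
      exact eq_of_jumpTime_le_of_lt ((jumpTime_le_coe_iff hj).2 (le_gridIndex_mul (hδ n) _)) hna
    have hsupp : ∀ i, h i ≠ y (jumpTime y j).toNNReal →
        gridWeight Λ h μ (δ n) (fun k => y (k * δ n)) (m n) i = 0 := fun i hi =>
      gridWeight_support _ _ _ i (by rwa [hyb])
    simp only [Function.comp_apply]
    rw [hm1 n, Matrix.smul_vecMul, Matrix.vecMul_smul, ← Matrix.vecMul_vecMul,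
      ← Matrix.vecMul_vecMul, vecMul_diagonal_levelInd, vecMul_diagonal_levelInd,
      levelInd_mul_of_support hsupp, smul_smul, ← pow_succ, gridWeight, hyc]

/-- The grid filter converges to the filter along each path for which the unnormalized filter
does not vanish. -/
theorem tendsto_normalize_gridWeight (hΛ : IsRateMatrix Λ) {ν : O → I → ℝ} (hμ : ∀ i, 0 ≤ μ i)
    (hy : IsStepPath y) {t : ℝ≥0} (hpos : ∀ s ≤ t, 0 < ∑ i, unnormPath Λ h μ y s i)
    {δ : ℕ → ℝ≥0} (hδ : ∀ n, 0 < δ n) (hδ0 : Tendsto δ atTop (𝓝 0)) {N : ℕ → ℕ}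
    (hN : ∀ n, N n * δ n = t) :
    Tendsto (fun n => normalize (gridWeight Λ h μ (δ n) (fun k => y (k * δ n)) (N n))) atTop
      (𝓝 (filterPath Λ h ν μ y t)) ∧
    ∀ᶠ n in atTop, 0 < ∑ i, gridWeight Λ h μ (δ n) (fun k => y (k * δ n)) (N n) i := by
  obtain ⟨h1, h2⟩ := hy.jumpCount_spec t
  have hj := jumpTime_ne_top_of_le h1
  have hlim := tendsto_gridWeight_of_gridIndex (m := N) (s := t) hδ hδ0 hj
    (tendsto_gridWeight_gridIndex (Λ := Λ) (h := h) (μ := μ) hy hδ hδ0 hj)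
    (Eventually.of_forall fun n => by
      refine Nat.ceil_le.2 ((div_le_iff₀ (hδ n)).2 ?_)
      rw [hN]
      exact (jumpTime_le_coe_iff hj).1 h1)
    (Eventually.of_forall fun n => by rw [hN]; exact h2) (by simp [hN])
  change Tendsto _ _ (𝓝 (unnormPath Λ h μ y t)) at hlim
  have hc : ∀ n, 0 < (δ n : ℝ)⁻¹ ^ jumpCount y t := fun n =>
    pow_pos (inv_pos.2 (NNReal.coe_pos.2 (hδ n))) _
  constructor
  · rw [filterPath_eq_normalize hΛ hμ hy hpos]
    refine ((continuousAt_normalize (hpos t le_rfl).ne').tendsto.comp hlim).congr fun n => ?_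
    exact normalize_smul (hc n).ne' _
  · have hsum := ((show Continuous fun x : I → ℝ => ∑ i, x i by fun_prop).tendsto _).comp hlim
    filter_upwards [hsum.eventually (lt_mem_nhds (hpos t le_rfl))] with n hn
    simp only [Function.comp_apply, Pi.smul_apply, smul_eq_mul, ← Finset.mul_sum] at hn
    exact (mul_pos_iff_of_pos_left (hc n)).1 hn

end Grid

/-! ### The σ-algebra generated by a step process -/

section GridValues

theorem comap_top_le_of_measurableSet_preimage {Ω S : Type*} [Finite S] {m : MeasurableSpace Ω}
    {Z : Ω → S} (hZ : ∀ a, MeasurableSet[m] (Z ⁻¹' {a})) : MeasurableSpace.comap Z ⊤ ≤ m := by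
  rintro _ ⟨B, -, rfl⟩
  rw [← Set.biUnion_preimage_singleton]
  exact MeasurableSet.biUnion (Set.to_countable B) fun a _ => hZ a

theorem pastSigma_le {Ω S : Type*} [Finite S] {m : MeasurableSpace Ω} {Z : ℝ≥0 → Ω → S}
    (hZ : ∀ t a, MeasurableSet[m] (Z t ⁻¹' {a})) (t : ℝ≥0) : pastSigma Z t ≤ m :=
  iSup₂_le fun s _ => comap_top_le_of_measurableSet_preimage (hZ s)

theorem measurableSet_pastSigma_preimage {Ω S : Type*} (Z : ℝ≥0 → Ω → S) {s t : ℝ≥0}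
    (hst : s ≤ t) (B : Set S) : MeasurableSet[pastSigma Z t] (Z s ⁻¹' B) :=
  le_iSup₂ (f := fun (r : ℝ≥0) (_ : r ≤ t) => MeasurableSpace.comap (Z r) ⊤) s hst _
    ⟨B, trivial, rfl⟩

variable {Ω : Type*}

/-- The values of the process on the grid `0, δ, …, Nδ`. -/
def gridValues {S : Type*} (Y : ℝ≥0 → Ω → S) (δ : ℝ≥0) (N : ℕ) (ω : Ω) : Fin (N + 1) → S :=
  fun k => Y ((k : ℕ) * δ) ω

theorem comap_gridValues_le {S : Type*} [Finite S] {m : MeasurableSpace Ω} {Y : ℝ≥0 → Ω → S}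
    {δ : ℝ≥0} {N : ℕ} (hY : ∀ k ≤ N, ∀ a, MeasurableSet[m] (Y (k * δ) ⁻¹' {a})) :
    MeasurableSpace.comap (gridValues Y δ N) ⊤ ≤ m := by
  refine comap_top_le_of_measurableSet_preimage fun z => ?_
  have : gridValues Y δ N ⁻¹' {z} = ⋂ k : Fin (N + 1), Y ((k : ℕ) * δ) ⁻¹' {z k} := by
    ext ω
    simp [gridValues, funext_iff]
  rw [this]
  exact MeasurableSet.iInter fun k => hY k (by lia) _

theorem monotone_comap_gridValues {S : Type*} (Y : ℝ≥0 → Ω → S) (c : ℝ≥0) (b : ℕ) :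
    Monotone fun n : ℕ => MeasurableSpace.comap (gridValues Y (c / 2 ^ n) (b * 2 ^ n)) ⊤ := by
  refine monotone_nat_of_le_succ fun n => ?_
  rintro _ ⟨B, -, rfl⟩
  refine ⟨(fun (z : Fin (b * 2 ^ (n + 1) + 1) → S) (k : Fin (b * 2 ^ n + 1)) =>
    z ⟨2 * k, by rw [pow_succ]; lia⟩) ⁻¹' B, trivial, ?_⟩
  rw [← Set.preimage_comp]
  congr 1
  ext ω k
  simp only [gridValues, Function.comp_apply]
  congr 1
  push_cast
  rw [pow_succ]
  field_simp

/-- For a right-continuous step process, the observations on refining grids generate the past. -/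
theorem iSup_comap_gridValues {S : Type*} [Finite S] {Y : ℝ≥0 → Ω → S}
    (hY : ∀ ω, IsStepPath fun t => Y t ω) {t : ℝ≥0} {δ : ℕ → ℝ≥0} {N : ℕ → ℕ}
    (hδ : ∀ n, 0 < δ n) (hδ0 : Tendsto δ atTop (𝓝 0)) (hN : ∀ n, N n * δ n = t) :
    ⨆ n, MeasurableSpace.comap (gridValues Y (δ n) (N n)) ⊤ = pastSigma Y t := by
  apply le_antisymm
  · refine iSup_le fun n => comap_gridValues_le fun k hk a =>
      measurableSet_pastSigma_preimage Y ?_ _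
    rw [← hN n]
    gcongr
  · refine iSup₂_le fun s hs => comap_top_le_of_measurableSet_preimage fun a => ?_
    have hk : ∀ n, ⌈s / δ n⌉₊ ≤ N n := fun n =>
      Nat.ceil_le.2 ((div_le_iff₀ (hδ n)).2 (by rwa [hN]))
    have hgrid : ∀ n, s ≤ ⌈s / δ n⌉₊ * δ n := fun n =>
      (div_le_iff₀ (hδ n)).1 (Nat.le_ceil _)
    have hlim : Tendsto (fun n => (⌈s / δ n⌉₊ : ℝ≥0) * δ n) atTop (𝓝[≥] s) := by
      refine tendsto_nhdsWithin_iff.2 ⟨?_, Eventually.of_forall hgrid⟩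
      have h1 : Tendsto (fun n => s + δ n) atTop (𝓝 (s + 0)) := tendsto_const_nhds.add hδ0
      rw [add_zero] at h1
      refine tendsto_of_tendsto_of_tendsto_of_le_of_le tendsto_const_nhds h1 hgrid fun n => ?_
      calc (⌈s / δ n⌉₊ : ℝ≥0) * δ n ≤ (s / δ n + 1) * δ n := by
            gcongr
            exact (Nat.ceil_lt_add_one zero_le).le
        _ = s + δ n := by rw [add_mul, div_mul_cancel₀ _ (hδ n).ne', one_mul]
    have hset : Y s ⁻¹' {a} = ⋃ n, ⋂ m, ⋂ (_ : n ≤ m), Y (⌈s / δ m⌉₊ * δ m) ⁻¹' {a} := by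
      ext ω
      have hev : ∀ᶠ n in atTop, Y (⌈s / δ n⌉₊ * δ n) ω = Y s ω := hlim.eventually (hY ω s).1
      simp only [Set.mem_iUnion, Set.mem_iInter, Set.mem_preimage, Set.mem_singleton_iff]
      rw [← eventually_atTop (p := fun m => Y (⌈s / δ m⌉₊ * δ m) ω = a)]
      constructor
      · intro hω
        filter_upwards [hev] with n hn
        rw [hn, hω]
      · intro hω
        obtain ⟨n, hn1, hn2⟩ := (hev.and hω).exists
        rw [← hn1, hn2]
    rw [hset]
    refine MeasurableSet.iUnion fun n => MeasurableSet.iInter fun m => MeasurableSet.iInter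
      fun _ => le_iSup (fun n => MeasurableSpace.comap (gridValues Y (δ n) (N n)) ⊤) m _ ?_
    exact ⟨{z | z ⟨⌈s / δ m⌉₊, Nat.lt_succ_of_le (hk m)⟩ = a}, trivial, rfl⟩

end GridValues

/-! ### Finite-dimensional laws of the Markov process -/

section Markov

theorem measureReal_eq_sum_inter_preimage {I Ω : Type*} [Fintype I] [MeasurableSpace Ω]
    {P : Measure Ω} [IsProbabilityMeasure P] {Z : Ω → I} (hZ : ∀ i, MeasurableSet (Z ⁻¹' {i}))
    (A : Set Ω) : P.real A = ∑ i, P.real (A ∩ Z ⁻¹' {i}) := by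
  have h1 := sum_measureReal_preimage_singleton (μ := P.restrict A) (f := Z) Finset.univ
    fun i _ => hZ i
  simp only [Finset.coe_univ, Set.preimage_univ, measureReal_restrict_apply_univ] at h1
  rw [← h1]
  refine Finset.sum_congr rfl fun i _ => ?_
  rw [measureReal_restrict_apply (hZ i), Set.inter_comm]

variable {I O Ω : Type*} [Fintype I] [DecidableEq I] [MeasurableSpace Ω] {P : Measure Ω}
  [IsProbabilityMeasure P] {Λ : Matrix I I ℝ} {h : I → O} {X : ℝ≥0 → Ω → I} {μ : I → ℝ}

/-- The Markov property on events. -/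
theorem IsMarkovWithGenerator.measureReal_inter (hX : IsMarkovWithGenerator P Λ X) (t s : ℝ≥0)
    {A : Set Ω} (hA : MeasurableSet[pastSigma X t] A) (i j : I) :
    P.real (A ∩ X t ⁻¹' {i} ∩ X (t + s) ⁻¹' {j})
      = P.real (A ∩ X t ⁻¹' {i}) * NormedSpace.exp ((s : ℝ) • Λ) i j := by
  have hm := pastSigma_le hX.1 t
  have hA' : MeasurableSet[pastSigma X t] (A ∩ X t ⁻¹' {i}) :=
    hA.inter (measurableSet_pastSigma_preimage X le_rfl {i})
  have hfun : (fun ω => (Pi.single j (1 : ℝ) : I → ℝ) (X (t + s) ω))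
      = (X (t + s) ⁻¹' {j}).indicator fun _ => (1 : ℝ) := by
    ext ω
    by_cases hω : X (t + s) ω = j
    · simp [hω]
    · simp [hω]
  have hint : Integrable (fun ω => (Pi.single j (1 : ℝ) : I → ℝ) (X (t + s) ω)) P := by
    rw [hfun]
    exact (integrable_const 1).indicator (hX.1 _ j)
  have h1 := setIntegral_condExp hm hint hA'
  have h2 : ∫ ω in A ∩ X t ⁻¹' {i}, (P[fun ω => (Pi.single j (1 : ℝ) : I → ℝ) (X (t + s) ω) |
      pastSigma X t]) ω ∂P
      = ∫ ω in A ∩ X t ⁻¹' {i}, NormedSpace.exp ((s : ℝ) • Λ) i j ∂P := by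
    refine setIntegral_congr_ae (hm _ hA') ?_
    filter_upwards [hX.2 t s (Pi.single j 1)] with ω hω hωA
    rw [hω, hωA.2, Matrix.mulVec_single_one, Matrix.col_apply]
  rw [h2, setIntegral_const, smul_eq_mul, hfun, setIntegral_indicator (hX.1 _ j),
    setIntegral_const, smul_eq_mul, mul_one] at h1
  exact h1.symm

/-- The joint law of the observations on a grid and of the current state of the signal. -/
theorem IsMarkovWithGenerator.measureReal_grid (hX : IsMarkovWithGenerator P Λ X)
    (hμ : ∀ i, μ i = P.real (X 0 ⁻¹' {i})) (δ : ℝ≥0) (a : ℕ → O) (k : ℕ) (i : I) :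
    P.real ({ω | ∀ l ≤ k, h (X (l * δ) ω) = a l} ∩ X (k * δ) ⁻¹' {i})
      = gridWeight Λ h μ δ a k i := by
  induction k generalizing i with
  | zero =>
    have hset : {ω | ∀ l ≤ 0, h (X ((l : ℕ) * δ) ω) = a l} ∩ X ((0 : ℕ) * δ) ⁻¹' {i}
        = {ω | h i = a 0} ∩ X 0 ⁻¹' {i} := by
      ext ω
      simp only [Set.mem_inter_iff, Set.mem_ofPred_eq, nonpos_iff_eq_zero, forall_eq,
        Nat.cast_zero, zero_mul, Set.mem_preimage, Set.mem_singleton_iff]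
      exact and_congr_left fun hω => by rw [hω]
    rw [hset]
    by_cases hi : h i = a 0
    · simp [gridWeight, levelInd_apply_of_eq hi, hi, hμ]
    · simp [gridWeight, levelInd_apply_of_ne hi, hi]
  | succ k ih =>
    by_cases hi : h i = a (k + 1)
    · have hset : {ω | ∀ l ≤ k + 1, h (X (l * δ) ω) = a l} ∩ X ((k + 1 : ℕ) * δ) ⁻¹' {i}
          = {ω | ∀ l ≤ k, h (X (l * δ) ω) = a l} ∩ X ((k + 1 : ℕ) * δ) ⁻¹' {i} := by
        ext ω
        refine and_congr_left fun hω => ⟨fun H l hl => H l (by lia), fun H l hl => ?_⟩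
        rcases hl.lt_or_eq with hlt | rfl
        · exact H l (by lia)
        · rw [show X ((k + 1 : ℕ) * δ) ω = i from hω, hi]
      have hE : MeasurableSet[pastSigma X (k * δ)] {ω | ∀ l ≤ k, h (X (l * δ) ω) = a l} := by
        simp only [Set.ofPred_forall]
        refine MeasurableSet.iInter fun l => MeasurableSet.iInter fun hl => ?_
        exact measurableSet_pastSigma_preimage X (s := l * δ) (by gcongr) (h ⁻¹' {a l})
      rw [hset, gridWeight, Pi.mul_apply, levelInd_apply_of_eq hi, one_mul,
        measureReal_eq_sum_inter_preimage (hX.1 (k * δ)), Matrix.vecMul, dotProduct]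
      refine Finset.sum_congr rfl fun l _ => ?_
      rw [← ih l, ← hX.measureReal_inter _ δ hE, Set.inter_right_comm]
      congr 4
      push_cast
      ring
    · have hset : {ω | ∀ l ≤ k + 1, h (X (l * δ) ω) = a l} ∩ X ((k + 1 : ℕ) * δ) ⁻¹' {i}
          = ∅ := by
        ext ω
        simp only [Set.mem_inter_iff, Set.mem_ofPred_eq, Set.mem_preimage, Set.mem_singleton_iff,
          Set.mem_empty_iff_false, iff_false, not_and]
        intro H hω
        exact hi (hω ▸ H (k + 1) le_rfl)
      rw [hset, measureReal_empty, gridWeight_support _ _ _ i hi]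

/-- Almost surely the signal makes no jump of rate zero. On a grid of mesh `δ` the probability of
seeing such a jump is at most `(t / δ) * o(δ)`. -/
theorem IsMarkovWithGenerator.measure_jump_eq_zero (hX : IsMarkovWithGenerator P Λ X)
    (hΛ : IsRateMatrix Λ) (hstep : ∀ ω, IsStepPath fun t => X t ω) {i j : I} (hij : i ≠ j)
    (hrate : Λ i j = 0) (t : ℝ≥0) :
    P {ω | ∃ s, 0 < s ∧ s ≤ t ∧ (∀ᶠ r in 𝓝[<] s, X r ω = i) ∧ X s ω = j} = 0 := by
  rcases eq_zero_or_pos t with rfl | ht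
  · convert! measure_empty (μ := P)
    ext ω
    simp only [Set.mem_ofPred_eq, Set.mem_empty_iff_false, iff_false]
    rintro ⟨s, hs, hs0, -⟩
    exact hs.not_ge hs0
  set δ : ℕ → ℝ≥0 := fun n => t / (n + 1) with hδdef
  have hδ : ∀ n, 0 < δ n := fun n => div_pos ht (by positivity)
  have hδt : ∀ n : ℕ, ((n + 1 : ℕ) : ℝ≥0) * δ n = t := fun n => by
    simp only [hδdef]
    push_cast
    rw [mul_div_cancel₀]
    positivity
  have hδ0 : Tendsto δ atTop (𝓝 0) := by
    rw [← NNReal.tendsto_coe]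
    simp only [hδdef]
    push_cast
    simpa [div_eq_mul_inv] using
      (tendsto_one_div_add_atTop_nhds_zero_nat (𝕜 := ℝ)).const_mul (t : ℝ)
  set B : ℕ → Set Ω := fun n => ⋃ k ∈ Finset.range (n + 1),
    X (k * δ n) ⁻¹' {i} ∩ X (k * δ n + δ n) ⁻¹' {j} with hB
  have hPB : ∀ n, P.real (B n) ≤ t * ((δ n : ℝ)⁻¹ * NormedSpace.exp ((δ n : ℝ) • Λ) i j) := by
    intro n
    have hexp := exp_smul_apply_nonneg hΛ.1 (δ n).coe_nonneg i j
    calc P.real (B n) ≤ ∑ k ∈ Finset.range (n + 1),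
          P.real (X (k * δ n) ⁻¹' {i} ∩ X (k * δ n + δ n) ⁻¹' {j}) :=
          measureReal_biUnion_finset_le _ _
      _ ≤ ∑ k ∈ Finset.range (n + 1), NormedSpace.exp ((δ n : ℝ) • Λ) i j := by
          refine Finset.sum_le_sum fun k _ => ?_
          have h1 := hX.measureReal_inter (k * δ n) (δ n) MeasurableSet.univ i j
          rw [Set.univ_inter] at h1
          rw [h1]
          exact mul_le_of_le_one_left hexp measureReal_le_one
      _ = t * ((δ n : ℝ)⁻¹ * NormedSpace.exp ((δ n : ℝ) • Λ) i j) := by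
          have h2 : (t : ℝ) = ((n + 1 : ℕ) : ℝ) * δ n := by
            rw [← hδt n]; push_cast; rfl
          have h3 : (δ n : ℝ) ≠ 0 := (NNReal.coe_pos.2 (hδ n)).ne'
          rw [Finset.sum_const, Finset.card_range, nsmul_eq_mul, h2]
          field_simp
  have hlim : Tendsto (fun n => P (B n)) atTop (𝓝 0) := by
    have h1 := (tendsto_inv_mul_exp_apply (Λ := Λ) hij (fun n => NNReal.coe_pos.2 (hδ n))
      (NNReal.tendsto_coe.2 hδ0)).const_mul (t : ℝ)
    rw [hrate, mul_zero] at h1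
    have h2 := squeeze_zero (fun n => measureReal_nonneg) hPB h1
    have h3 := ENNReal.tendsto_ofReal h2
    simpa [ofReal_measureReal] using h3
  have hsub : {ω | ∃ s, 0 < s ∧ s ≤ t ∧ (∀ᶠ r in 𝓝[<] s, X r ω = i) ∧ X s ω = j}
      ⊆ ⋃ n, ⋂ m, ⋂ (_ : n ≤ m), B m := by
    rintro ω ⟨s, hs0, hst, hleft, hs⟩
    obtain ⟨u, hu, hxu⟩ := (mem_nhdsLT_iff_exists_Ioo_subset' hs0).1 hleft
    obtain ⟨v, hv, hxv⟩ := (hstep ω).exists_gap s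
    have hmesh : ∀ᶠ n in atTop, δ n < min (s - u) (v - s) :=
      hδ0.eventually (gt_mem_nhds (lt_min (tsub_pos_of_lt hu) (tsub_pos_of_lt hv)))
    obtain ⟨n, hn⟩ := eventually_atTop.1 hmesh
    refine Set.mem_iUnion.2 ⟨n, Set.mem_iInter₂.2 fun m hm => ?_⟩
    have hδu := (hn m hm).trans_le (min_le_left _ _)
    have hδv := (hn m hm).trans_le (min_le_right _ _)
    -- the grid interval `(kδ, (k+1)δ]` that contains `s`
    obtain ⟨k, hk⟩ : ∃ k, ⌈s / δ m⌉₊ = k + 1 :=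
      Nat.exists_eq_add_of_le' (Nat.ceil_pos.2 (div_pos hs0 (hδ m)))
    have hks : (k : ℝ≥0) * δ m < s := by
      rw [← lt_div_iff₀ (hδ m)]
      exact Nat.lt_ceil.1 (by lia)
    have hsk : s ≤ k * δ m + δ m := by
      have := (div_le_iff₀ (hδ m)).1 (Nat.le_ceil (s / δ m))
      rw [hk] at this
      push_cast at this
      rwa [add_mul, one_mul] at this
    have hkm : k < m + 1 := by
      have h1 : (k : ℝ≥0) * δ m < ((m + 1 : ℕ) : ℝ≥0) * δ m := by
        rw [hδt m]; exact hks.trans_le hst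
      exact_mod_cast lt_of_mul_lt_mul_right h1 zero_le
    refine Set.mem_biUnion (Finset.mem_coe.2 (Finset.mem_range.2 hkm)) ⟨hxu ⟨?_, hks⟩, ?_⟩
    · have h1 : δ m + u < s := lt_tsub_iff_right.1 hδu
      exact lt_of_add_lt_add_left (h1.trans_le (hsk.trans_eq (add_comm _ _)))
    · refine (hxv _ hsk ?_).trans hs
      have h1 : δ m + s < v := lt_tsub_iff_right.1 hδv
      refine lt_of_le_of_lt ?_ h1
      rw [add_comm]
      gcongr
  refine measure_mono_null hsub (measure_iUnion_null fun n => ?_)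
  refine le_antisymm (ge_of_tendsto hlim ?_) zero_le
  filter_upwards [eventually_ge_atTop n] with m hm
  exact measure_mono (Set.iInter₂_subset m hm)

/-- Almost surely the unnormalized filter does not vanish before time `t`. -/
theorem IsMarkovWithGenerator.ae_unnormPath_pos (hX : IsMarkovWithGenerator P Λ X)
    (hΛ : IsRateMatrix Λ) (hstep : ∀ ω, IsStepPath fun t => X t ω)
    (hμ : ∀ i, μ i = P.real (X 0 ⁻¹' {i})) (t : ℝ≥0) :
    ∀ᵐ ω ∂P, ∀ s ≤ t, 0 < ∑ i, unnormPath Λ h μ (fun r => h (X r ω)) s i := by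
  have hμ0 : ∀ i, 0 ≤ μ i := fun i => by rw [hμ]; exact measureReal_nonneg
  have h1 : ∀ᵐ ω ∂P, ∀ i, X 0 ω = i → 0 < μ i := by
    refine ae_all_iff.2 fun i => ?_
    rcases (hμ0 i).lt_or_eq with hi | hi
    · exact Eventually.of_forall fun _ _ => hi
    · have hnull : P (X 0 ⁻¹' {i}) = 0 := by
        rw [hμ] at hi
        exact (measureReal_eq_zero_iff).1 hi.symm
      filter_upwards [measure_eq_zero_iff_ae_notMem.1 hnull] with ω hω hωi
      exact absurd hωi hω
  have h2 : ∀ᵐ ω ∂P, ∀ i j, i ≠ j → Λ i j = 0 →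
      ¬ ∃ s, 0 < s ∧ s ≤ t ∧ (∀ᶠ r in 𝓝[<] s, X r ω = i) ∧ X s ω = j := by
    simp only [ae_all_iff]
    intro i j hij hrate
    exact measure_eq_zero_iff_ae_notMem.1 (hX.measure_jump_eq_zero hΛ hstep hij hrate t)
  filter_upwards [h1, h2] with ω hω1 hω2 s hst
  have hpos := unnormPath_apply_pos (h := h) (y := fun r => h (X r ω)) hΛ hμ0 (hstep ω)
    (fun _ => rfl) (t := t) (hω1 _ rfl) (fun s hs0 hst i hev hi =>
      lt_of_le_of_ne (hΛ.1 _ _ hi) fun h0 => hω2 i _ hi h0.symm ⟨s, hs0, hst, hev, rfl⟩) hst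
  exact Finset.sum_pos' (fun i _ =>
    (unnormPath_mem_levelCone hΛ hμ0 ((hstep ω).comp h) s).1 i) ⟨_, Finset.mem_univ _, hpos⟩

/-! ### Conditioning on the observation -/

/-- The conditional probability given a random variable, on an atom of that variable. -/
theorem condExp_comap_mul_measureReal {S : Type*} {Z : Ω → S}
    (hZ : MeasurableSpace.comap Z ⊤ ≤ ‹MeasurableSpace Ω›) {A : Set Ω} (hA : MeasurableSet A)
    (ω : Ω) : (P⟦A | MeasurableSpace.comap Z ⊤⟧) ω * P.real (Z ⁻¹' {Z ω})
      = P.real (Z ⁻¹' {Z ω} ∩ A) := by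
  set g := P⟦A | MeasurableSpace.comap Z ⊤⟧ with hg
  have hmeas : Measurable[MeasurableSpace.comap Z ⊤] g :=
    stronglyMeasurable_condExp.measurable
  have hatom : MeasurableSet[MeasurableSpace.comap Z ⊤] (Z ⁻¹' {Z ω}) := ⟨_, trivial, rfl⟩
  obtain ⟨B, -, hB⟩ := hmeas (measurableSet_singleton (g ω))
  have hconst : ∀ ω' ∈ Z ⁻¹' {Z ω}, g ω' = g ω := by
    intro ω' hω'
    have h1 : ω ∈ Z ⁻¹' B := by rw [hB]; rfl
    have h2 : ω' ∈ Z ⁻¹' B := by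
      rw [Set.mem_preimage, show Z ω' = Z ω from hω']; exact h1
    rw [hB] at h2
    exact h2
  have h1 := setIntegral_condExp hZ (f := A.indicator fun _ => (1 : ℝ))
    ((integrable_const (μ := P) 1).indicator hA) hatom
  rw [← hg, setIntegral_congr_fun (hZ _ hatom) hconst, setIntegral_const,
    setIntegral_indicator hA, setIntegral_const, smul_eq_mul, smul_eq_mul, mul_one] at h1
  rw [mul_comm, h1]

/-- The conditional law of the signal given the grid observations is the grid filter. -/
theorem IsMarkovWithGenerator.condExp_gridValues (hX : IsMarkovWithGenerator P Λ X) [Finite O]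
    (hμ : ∀ i, μ i = P.real (X 0 ⁻¹' {i})) (δ : ℝ≥0) (N : ℕ) (i : I) (ω : Ω)
    (hpos : 0 < ∑ i, gridWeight Λ h μ δ (fun k => h (X (k * δ) ω)) N i) :
    (P⟦X (N * δ) ⁻¹' {i} |
        MeasurableSpace.comap (gridValues (fun t ω => h (X t ω)) δ N) ⊤⟧) ω
      = normalize (gridWeight Λ h μ δ (fun k => h (X (k * δ) ω)) N) i := by
  set Z := gridValues (fun t ω => h (X t ω)) δ N
  have hmeasX : ∀ t (B : Set I), MeasurableSet (X t ⁻¹' B) := fun t B =>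
    comap_top_le_of_measurableSet_preimage (hX.1 t) _ ⟨B, trivial, rfl⟩
  have hatom : Z ⁻¹' {Z ω} = {ω' | ∀ l ≤ N, h (X (l * δ) ω') = h (X (l * δ) ω)} := by
    ext ω'
    simp only [Set.mem_preimage, Set.mem_singleton_iff, funext_iff, Set.mem_ofPred_eq]
    exact ⟨fun H l hl => H ⟨l, Nat.lt_succ_of_le hl⟩, fun H k => H k (by lia)⟩
  have h1 := condExp_comap_mul_measureReal (P := P) (Z := Z)
    (comap_gridValues_le fun k _ a => hmeasX _ (h ⁻¹' {a})) (hX.1 (N * δ) i) ω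
  rw [measureReal_eq_sum_inter_preimage (hX.1 (N * δ)) (Z ⁻¹' {Z ω})] at h1
  simp only [hatom, hX.measureReal_grid hμ δ (fun k => h (X (k * δ) ω)) N] at h1
  rw [normalize, Pi.smul_apply, smul_eq_mul, eq_inv_mul_iff_mul_eq₀ hpos.ne', mul_comm]
  exact h1

/-- The filter is a version of the conditional law of the signal, by Lévy's upward theorem along
refining grids. -/
theorem IsMarkovWithGenerator.filterPath_ae_eq [Finite O] (hX : IsMarkovWithGenerator P Λ X)
    (hΛ : IsRateMatrix Λ) (hstep : ∀ ω, IsStepPath fun t => X t ω)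
    (hμ : ∀ i, μ i = P.real (X 0 ⁻¹' {i})) (ν : O → I → ℝ) (t : ℝ≥0) (i : I) :
    (fun ω => filterPath Λ h ν μ (fun s => h (X s ω)) t i)
      =ᵐ[P] P⟦X t ⁻¹' {i} | pastSigma (fun s ω => h (X s ω)) t⟧ := by
  have hμ0 : ∀ i, 0 ≤ μ i := fun i => by rw [hμ]; exact measureReal_nonneg
  -- dyadic grids of `[0, t]`, reduced to the point `0` when `t = 0`
  obtain ⟨c, b, hc, hbc⟩ : ∃ (c : ℝ≥0) (b : ℕ), 0 < c ∧ b * c = t := by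
    rcases eq_zero_or_pos t with rfl | ht
    · exact ⟨1, 0, one_pos, by simp⟩
    · exact ⟨t, 1, ht, by simp⟩
  set δ : ℕ → ℝ≥0 := fun n => c / 2 ^ n with hδdef
  set N : ℕ → ℕ := fun n => b * 2 ^ n with hNdef
  have hδ : ∀ n, 0 < δ n := fun n => div_pos hc (by positivity)
  have hδ0 : Tendsto δ atTop (𝓝 0) := by
    rw [← NNReal.tendsto_coe]
    simp only [hδdef]
    push_cast
    exact tendsto_const_nhds.div_atTop (tendsto_pow_atTop_atTop_of_one_lt one_lt_two)
  have hN : ∀ n, N n * δ n = t := fun n => by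
    simp only [hδdef, hNdef]
    push_cast
    rw [← hbc]
    field_simp
  have hmeasX : ∀ t (B : Set I), MeasurableSet (X t ⁻¹' B) := fun t B =>
    comap_top_le_of_measurableSet_preimage (hX.1 t) _ ⟨B, trivial, rfl⟩
  let ℱ : Filtration ℕ ‹MeasurableSpace Ω› :=
    { seq := fun n => MeasurableSpace.comap (gridValues (fun t ω => h (X t ω)) (δ n) (N n)) ⊤
      mono' := monotone_comap_gridValues _ c b
      le' := fun n => comap_gridValues_le fun k _ a => hmeasX _ (h ⁻¹' {a}) }
  have hsup : ⨆ n, ℱ n = pastSigma (fun s ω => h (X s ω)) t :=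
    iSup_comap_gridValues (fun ω => (hstep ω).comp h) hδ hδ0 hN
  have hlevy := tendsto_ae_condExp (μ := P) (ℱ := ℱ)
    ((X t ⁻¹' {i}).indicator fun _ => (1 : ℝ))
  rw [hsup] at hlevy
  filter_upwards [hlevy, hX.ae_unnormPath_pos (h := h) hΛ hstep hμ t] with ω hω hpos
  obtain ⟨h1, h2⟩ := tendsto_normalize_gridWeight (ν := ν) hΛ hμ0 ((hstep ω).comp h) hpos
    hδ hδ0 hN
  refine tendsto_nhds_unique ((tendsto_pi_nhds.1 h1 i).congr' ?_) hω
  filter_upwards [h2] with n hn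
  have h3 := hX.condExp_gridValues hμ (δ n) (N n) i ω hn
  rw [hN n] at h3
  exact h3.symm

end Markov

end

end NoiseFreeFilter

theorem theorem2 {I O Ω : Type*} [Fintype I] [DecidableEq I]
    [TopologicalSpace I] [DiscreteTopology I] [Finite O]
    [MeasurableSpace Ω] (P : Measure Ω) [IsProbabilityMeasure P]
    (Λ : Matrix I I ℝ) (hΛ : NoiseFreeFilter.IsRateMatrix Λ)
    (h : I → O) (hsurj : Function.Surjective h)
    (ν : O → I → ℝ) (hν : ∀ a, ν a ∈ NoiseFreeFilter.levelSimplex h a)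
    (X : ℝ≥0 → Ω → I) (hX : NoiseFreeFilter.IsMarkovWithGenerator P Λ X)
    (hcadlag : ∀ ω, NoiseFreeFilter.IsCadlag (fun t => X t ω))
    (μ : I → ℝ) (hμ : ∀ i, μ i = P.real (X 0 ⁻¹' {i}))
    (Y : ℝ≥0 → Ω → O) (hY : ∀ t ω, Y t ω = h (X t ω)) :
    ∃ π : ℝ≥0 → Ω → I → ℝ,
      (∀ ω, NoiseFreeFilter.SolvesFilteringEq Λ h ν μ (fun t => Y t ω) (fun t => π t ω)) ∧
      (∀ ω (p : ℝ≥0 → I → ℝ),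
        NoiseFreeFilter.SolvesFilteringEq Λ h ν μ (fun t => Y t ω) p → ∀ t, p t = π t ω) ∧
      (∀ ω, NoiseFreeFilter.FollowsFlowWithJumps Λ h ν μ (fun t => Y t ω) (fun t => π t ω)) ∧
      (∀ (t : ℝ≥0) (i : I),
        (fun ω => π t ω i) =ᵐ[P] P⟦X t ⁻¹' {i} | NoiseFreeFilter.pastSigma Y t⟧) := by
  obtain rfl : Y = fun t ω => h (X t ω) := funext fun t => funext fun ω => hY t ω
  have hstep : ∀ ω, NoiseFreeFilter.IsStepPath fun t => X t ω := fun ω => (hcadlag ω).isStepPath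
  have hy := fun ω => (hstep ω).comp h
  have hμ0 : ∀ i, 0 ≤ μ i := fun i => by rw [hμ]; exact measureReal_nonneg
  have hflow := fun ω => NoiseFreeFilter.followsFlowWithJumps_filterPath hΛ hν hμ0 (hy ω)
  have hsolves := fun ω => NoiseFreeFilter.solvesFilteringEq_of_followsFlowWithJumps (hy ω)
    (NoiseFreeFilter.isCadlag_filterPath hΛ hν hμ0 (hy ω)) (hflow ω)
  exact ⟨fun t ω => NoiseFreeFilter.filterPath Λ h ν μ (fun s => h (X s ω)) t, hsolves,
    fun ω p hp t => hp.unique (hy ω) (hsolves ω) t, hflow,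
    fun t i => hX.filterPath_ae_eq hΛ hstep hμ ν t i⟩
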